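/- For real $|q|<1$ put $\varphi(q)=\sum_{n=-\infty}^{\infty}q^{n^2}$ and $\chi(q)=\prod_{k=0}^{\infty}(1+q^{2k+1})$. For a positive rational number $n$, the Ramanujan--Weber class invariant is $G_n=2^{-1/4}q^{-1/24}\chi(q)$ with $q=e^{-\pi\sqrt n}$. **Theorem.** Let $$m=7^{3/2}\left\{1+\left(\frac{\cos\frac{\pi}{7}}{2\cos^2\frac{2\pi}{7}}\right)^{2/7}+\left(\frac{\cos\frac{2\pi}{7}}{2\cos^2\frac{3\pi}{7}}\right)^{2/7}+\left(\frac{\cos\frac{3\pi}{7}}{2\cos^2\frac{\pi}{7}}\right)^{2/7}\right\}^{-2},$$ $$s=12m^2\left(9(7-m^2)+\sqrt3\,\sqrt{27(m^4+49)+122m^2}\right),\qquad p=1+\frac{10m^2}{s^{1/3}}-\frac{s^{1/3}}{6}.$$ Then $m=\varphi^2(e^{-\pi\sqrt7})/\varphi^2(e^{-7\pi\sqrt7})$, the numbers $s$ and $p$ are positive (all roots are the positive real ones), and $$G_{343}=2^{1/4}p^{-1/7}.$$ -/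

import Mathlib

open Real

noncomputable section

/-- The infinite `q`-shifted factorial `(a; q)_∞ = ∏_{k ≥ 0} (1 - a q^k)`, for `|q| < 1`. -/
def qPochhammerInf (a q : ℝ) : ℝ := ∏' k : ℕ, (1 - a * q ^ k)

/-- Ramanujan's theta function `φ(q) = ∑_{n ∈ ℤ} q^{n²}`, for `|q| < 1`. -/
def ramanujanPhi (q : ℝ) : ℝ := ∑' n : ℤ, q ^ (n ^ 2)

/-- Ramanujan's function `χ(q) = (-q; q²)_∞`, for `|q| < 1`. -/
def ramanujanChi (q : ℝ) : ℝ := qPochhammerInf (-q) (q ^ 2)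

/-- The Ramanujan-Weber class invariant `G_n = 2^{-1/4} q^{-1/24} χ(q)` with
`q = exp (-π √n)`, for a positive rational number `n`. -/
def classInvariantG (n : ℚ) : ℝ :=
  (2 : ℝ) ^ (-(1 / 4) : ℝ) * exp (-π * √(n : ℝ)) ^ (-(1 / 24) : ℝ) *
    ramanujanChi (exp (-π * √(n : ℝ)))

end

/-! Let a_j be the sum of r^(n²) over n ≡ j (mod 7), so that a₀ = φ(r^49) and φ(r) = a₀ + 2a₁ + 2a₂
+ 2a₃, and let P = 8a₁a₂a₃/a₀³. Three facts tie these series together. Multiplication by a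
quaternion of norm 7 turns φ(r^7)⁴ into a quartic form in the a_j (`ramanujanPhi_pow_four`). The
products a_{w+i}a_{w-i} form a matrix of rank at most two, whose vanishing minors give a relation,
cubic in P, between P and φ(r^7)⁴/a₀⁴ (`thetaResidue_seven_relations`). The triple product expresses
P through χ(r^7) and χ(r^49) (`thetaResidue_seven_mul_mul`).

These facts are used at two values of r. At r = exp(-π√7/49), theta inversion gives φ(r^7)⁴ = 7a₀⁴,
and the relation forces P = 1. Hence G₇ = 2^(1/4), and the ratios 2a_j/a₀ satisfy a cyclic system
solved by the cosines (`cyclic_system_solution`). Since φ(r) = 7^(3/4) φ(e^{-7π√7}), this evaluates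
m.

At r = exp(-π/√7), the relation is a cubic for P with coefficients in m, and Cardano's formula gives
P = p. With f = 2^(1/4) G₃₄₃, the product formula and the value of G₇ give P f^7 = 8√2, which is the
claim. -/

/-! ### Theta series along residue classes. -/

/-- The theta series `∑ r^(n²)` over the integers `n ≡ j (mod N)`. -/
noncomputable def thetaResidue (N : ℤ) (r : ℝ) (j : ℤ) : ℝ := ∑' k : ℤ, r ^ ((N * k + j) ^ 2)

/-- The terms are the norms of the terms of `jacobiTheta₂` at purely imaginary arguments. -/
theorem summable_zpow_sq_mul_zpow {q z : ℝ} (hq : 0 < q) (hq1 : q < 1) (hz : 0 < z) :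
    Summable fun n : ℤ => q ^ (n ^ 2) * z ^ n := by
  have hτ : 0 < (Complex.I * (-(log q / π) : ℝ)).im := by
    have := log_neg hq hq1
    have : 0 < -(log q / π) := by
      rw [← neg_div]; exact div_pos (by linarith) pi_pos
    simpa using this
  have h := (summable_jacobiTheta₂_term_iff (Complex.I * (-(log z / (2 * π)) : ℝ))
    (Complex.I * (-(log q / π) : ℝ))).2 hτ
  refine h.norm.congr fun n => ?_
  rw [norm_jacobiTheta₂_term]
  simp only [Complex.mul_im, Complex.I_re, Complex.I_im, Complex.ofReal_re, Complex.ofReal_im,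
    zero_mul, one_mul, zero_add]
  have e1 : q ^ (n ^ 2) = exp (log q * n ^ 2) := by
    rw [← rpow_intCast, rpow_def_of_pos hq]; push_cast; rfl
  have e2 : z ^ n = exp (log z * n) := by
    rw [← rpow_intCast, rpow_def_of_pos hz]
  rw [e1, e2, ← exp_add]
  congr 1
  field_simp
  ring

theorem summable_zpow_sq {q : ℝ} (hq : 0 < q) (hq1 : q < 1) :
    Summable fun n : ℤ => q ^ (n ^ 2) := by
  simpa using summable_zpow_sq_mul_zpow hq hq1 one_pos

theorem residue_injective {N : ℤ} (hN : N ≠ 0) (j : ℤ) :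
    Function.Injective fun k : ℤ => N * k + j := fun a b h => by
  simpa [hN] using h

theorem hasSum_thetaResidue {N : ℤ} (hN : N ≠ 0) {r : ℝ} (hr : 0 < r) (hr1 : r < 1) (j : ℤ) :
    HasSum (fun k : ℤ => r ^ ((N * k + j) ^ 2)) (thetaResidue N r j) :=
  ((summable_zpow_sq hr hr1).comp_injective (residue_injective hN j)).hasSum

theorem thetaResidue_pos {N : ℤ} (hN : N ≠ 0) {r : ℝ} (hr : 0 < r) (hr1 : r < 1) (j : ℤ) :
    0 < thetaResidue N r j :=
  (hasSum_thetaResidue hN hr hr1 j).summable.tsum_pos (fun _ => (zpow_pos hr _).le) 0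
    (zpow_pos hr _)

theorem thetaResidue_add (N : ℤ) (r : ℝ) (j m : ℤ) :
    thetaResidue N r (j + N * m) = thetaResidue N r j := by
  unfold thetaResidue
  rw [← (Equiv.addRight m).tsum_eq fun k : ℤ => r ^ ((N * k + j) ^ 2)]
  refine tsum_congr fun k => ?_
  congr 2
  simp only [Equiv.coe_addRight]
  ring

theorem thetaResidue_neg (N : ℤ) (r : ℝ) (j : ℤ) :
    thetaResidue N r (-j) = thetaResidue N r j := by
  unfold thetaResidue
  rw [← (Equiv.neg ℤ).tsum_eq fun k : ℤ => r ^ ((N * k + j) ^ 2)]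
  refine tsum_congr fun k => ?_
  congr 1
  simp only [Equiv.neg_apply]
  ring

theorem thetaResidue_congr {N : ℤ} (r : ℝ) {i j : ℤ} (h : i ≡ j [ZMOD N]) :
    thetaResidue N r i = thetaResidue N r j := by
  obtain ⟨c, hc⟩ := h.symm.dvd
  rw [show i = j + N * c by linarith, thetaResidue_add]

theorem thetaResidue_zero (N : ℤ) (r : ℝ) :
    thetaResidue N r 0 = ramanujanPhi (r ^ (N ^ 2)) := by
  unfold thetaResidue ramanujanPhi
  refine tsum_congr fun k => ?_
  rw [← zpow_mul]
  ring_nf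

theorem hasSum_mul_periodic {N : ℕ} (hN : N ≠ 0) {r : ℝ} (hr : 0 < r) (hr1 : r < 1) {h : ℤ → ℝ}
    (hh : ∀ i j : ℤ, i ≡ j [ZMOD N] → h i = h j) :
    HasSum (fun n : ℤ => r ^ (n ^ 2) * h n)
      (∑ s ∈ Finset.range N, thetaResidue N r s * h s) := by
  have hN' : (N : ℤ) ≠ 0 := by exact_mod_cast hN
  have key : ∀ s ∈ Finset.range N, HasSum
      (fun n : ℤ => if n % N = s then r ^ (n ^ 2) * h n else 0)
      (thetaResidue N r s * h s) := by
    intro s hs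
    have hs' : (s : ℤ) % N = s := Int.emod_eq_of_lt (by positivity)
      (by exact_mod_cast Finset.mem_range.1 hs)
    rw [← (residue_injective hN' (s : ℤ)).hasSum_iff]
    · refine ((hasSum_thetaResidue hN' hr hr1 s).mul_right (h s)).congr_fun fun k => ?_
      have h1 : ((N : ℤ) * k + s) % N = s := by rw [Int.mul_add_emod_self_left, hs']
      simp only [Function.comp_apply, h1, if_true]
      rw [hh ((N : ℤ) * k + s) s (by rw [Int.ModEq, h1, hs'])]
    · intro n hn
      refine if_neg fun h => hn ⟨n / N, ?_⟩
      change (N : ℤ) * (n / N) + s = n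
      rw [← h]; exact Int.mul_ediv_add_emod n N
  refine (hasSum_sum key).congr_fun fun n => ?_
  have hnn := Int.emod_nonneg n hN'
  have hnl := Int.emod_lt_of_pos n (by positivity : (0 : ℤ) < N)
  rw [Finset.sum_eq_single (n % N).toNat]
  · rw [if_pos (by rw [Int.toNat_of_nonneg hnn])]
  · intro b _ hb
    refine if_neg fun h => hb ?_
    rw [h]; simp
  · intro h
    exact absurd (Finset.mem_range.2 (by omega)) h

theorem ramanujanPhi_eq_sum_thetaResidue {N : ℕ} (hN : N ≠ 0) {r : ℝ} (hr : 0 < r) (hr1 : r < 1) :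
    ramanujanPhi r = ∑ s ∈ Finset.range N, thetaResidue N r s := by
  have := (hasSum_mul_periodic hN hr hr1 (h := fun _ => 1) (fun _ _ _ => rfl)).tsum_eq
  simpa [ramanujanPhi] using this

theorem ramanujanPhi_pos {q : ℝ} (hq : 0 < q) (hq1 : q < 1) : 0 < ramanujanPhi q :=
  (summable_zpow_sq hq hq1).tsum_pos (fun _ => (zpow_pos hq _).le) 0 (zpow_pos hq _)

theorem hasSum_mul_prod_of_nonneg {ι κ : Type*} {f : ι → ℝ} {g : κ → ℝ} {a b : ℝ}
    (hf : HasSum f a) (hg : HasSum g b) (hf0 : ∀ i, 0 ≤ f i) (hg0 : ∀ i, 0 ≤ g i) :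
    HasSum (fun x : ι × κ => f x.1 * g x.2) (a * b) :=
  hf.mul hg (hf.summable.mul_of_nonneg hg.summable hf0 hg0)

theorem hasSum_int_even_add_odd {f : ℤ → ℝ} {a b : ℝ} (ha : HasSum (fun k => f (2 * k)) a)
    (hb : HasSum (fun k => f (2 * k + 1)) b) : HasSum f (a + b) := by
  have h2 : Function.Injective fun k : ℤ => 2 * k := mul_right_injective₀ two_ne_zero
  replace ha := h2.hasSum_range_iff.2 ha
  replace hb := ((add_left_injective 1).comp h2).hasSum_range_iff.2 hb
  refine ha.add_isCompl ?_ hb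
  simpa [Function.comp_def] using Int.isCompl_even_odd

/-! ### The fourth power of φ and a quaternion of norm seven. -/

/-- Reindexing of `ℤ⁴` by left multiplication with the quaternion `2 + i + j + k` of norm seven. -/
def quaternionSevenEquiv : (ℤ × ℤ) × (ℤ × ℤ) ≃ (ℤ × ℤ) × (ℤ × ℤ) where
  toFun v := ((v.1.1 + v.2.1 + v.2.2, v.1.2 + v.2.1 - v.2.2),
    (v.1.1 + 2 * v.2.1 + v.2.2, 2 * v.2.2 - v.1.2 - v.2.1))
  invFun v := ((2 * v.1.1 - v.1.2 - v.2.1 - v.2.2, v.1.1 + 2 * v.1.2 - v.2.1 + v.2.2),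
    (v.2.1 - v.1.1, v.1.2 + v.2.2))
  left_inv v := by ext <;> simp <;> ring
  right_inv v := by ext <;> simp <;> ring

/-- Multiplying by the quaternion turns seven times a sum of four squares into a² + b² + (7k + 3a +
2b)² + (7l + 2a - 3b)². The sums over k and l are residue series, depending only on a and b modulo
7. -/
theorem ramanujanPhi_pow_four_eq_sum {r : ℝ} (hr : 0 < r) (hr1 : r < 1) :
    ramanujanPhi (r ^ 7) ^ 4 = ∑ s ∈ Finset.range 7, ∑ t ∈ Finset.range 7,
      thetaResidue 7 r s * (thetaResidue 7 r t *
        (thetaResidue 7 r (3 * s + 2 * t) * thetaResidue 7 r (2 * s - 3 * t))) := by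
  have h7 : (7 : ℤ) ≠ 0 := by norm_num
  set B := thetaResidue 7 r with hB
  have hφ : HasSum (fun n : ℤ => (r ^ 7) ^ (n ^ 2)) (ramanujanPhi (r ^ 7)) :=
    (summable_zpow_sq (pow_pos hr 7) (pow_lt_one₀ hr.le hr1 (by norm_num))).hasSum
  have hφn : ∀ n : ℤ, 0 ≤ (r ^ 7) ^ (n ^ 2) := fun n => by positivity
  have h2 := hasSum_mul_prod_of_nonneg hφ hφ hφn hφn
  have h4 := hasSum_mul_prod_of_nonneg h2 h2 (fun n => by positivity) fun n => by positivity
  rw [← quaternionSevenEquiv.hasSum_iff] at h4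
  have hfib : ∀ v : ℤ × ℤ, HasSum (fun w : ℤ × ℤ =>
      ((fun x : (ℤ × ℤ) × (ℤ × ℤ) => (r ^ 7) ^ (x.1.1 ^ 2) * (r ^ 7) ^ (x.1.2 ^ 2) *
        ((r ^ 7) ^ (x.2.1 ^ 2) * (r ^ 7) ^ (x.2.2 ^ 2))) ∘ quaternionSevenEquiv) (v, w))
      (r ^ (v.1 ^ 2) * (r ^ (v.2 ^ 2) * (B (3 * v.1 + 2 * v.2) * B (2 * v.1 - 3 * v.2)))) := by
    intro v
    have ha := hasSum_thetaResidue h7 hr hr1 (3 * v.1 + 2 * v.2)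
    have hb := hasSum_thetaResidue h7 hr hr1 (2 * v.1 - 3 * v.2)
    have := ((hasSum_mul_prod_of_nonneg ha hb (fun n => by positivity)
      fun n => by positivity).mul_left (r ^ (v.2 ^ 2))).mul_left (r ^ (v.1 ^ 2))
    refine this.congr_fun fun w => ?_
    simp only [Function.comp_apply, quaternionSevenEquiv, Equiv.coe_fn_mk, ← zpow_natCast r 7,
      ← zpow_mul, ← zpow_add₀ hr.ne']
    congr 1
    push_cast
    ring
  have h5 := h4.prod_fiberwise hfib
  have hin : ∀ a : ℤ, HasSum
      (fun b : ℤ => r ^ (a ^ 2) * (r ^ (b ^ 2) * (B (3 * a + 2 * b) * B (2 * a - 3 * b))))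
      (r ^ (a ^ 2) * ∑ t ∈ Finset.range 7, B t * (B (3 * a + 2 * t) * B (2 * a - 3 * t))) := by
    intro a
    refine HasSum.mul_left _ (hasSum_mul_periodic (N := 7) (by norm_num) hr hr1
      (h := fun b => B (3 * a + 2 * b) * B (2 * a - 3 * b)) fun i j hij => ?_)
    have e1 : B (3 * a + 2 * i) = B (3 * a + 2 * j) :=
      thetaResidue_congr r ((hij.mul_left 2).add_left _)
    have e2 : B (2 * a - 3 * i) = B (2 * a - 3 * j) :=
      thetaResidue_congr r ((hij.mul_left 3).sub_left _)
    simp only [e1, e2]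
  have h6 := h5.prod_fiberwise hin
  have h7' := hasSum_mul_periodic (N := 7) (by norm_num) hr hr1
    (h := fun a => ∑ t ∈ Finset.range 7, B t * (B (3 * a + 2 * t) * B (2 * a - 3 * t)))
    fun i j hij => by
      refine Finset.sum_congr rfl fun t _ => ?_
      have e1 : B (3 * i + 2 * t) = B (3 * j + 2 * t) :=
        thetaResidue_congr r ((hij.mul_left 3).add_right _)
      have e2 : B (2 * i - 3 * t) = B (2 * j - 3 * t) :=
        thetaResidue_congr r ((hij.mul_left 2).sub_right _)
      simp only [e1, e2]
  have h8 := h6.unique h7'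
  simp only [Finset.mul_sum] at h8
  have h9 : ramanujanPhi (r ^ 7) ^ 4 = ramanujanPhi (r ^ 7) * ramanujanPhi (r ^ 7) *
      (ramanujanPhi (r ^ 7) * ramanujanPhi (r ^ 7)) := by ring
  rw [h9]
  exact h8

/-! ### A rank-two matrix and the modular relations of degree seven. -/

/-- Since 2x² + 2y² = (x + y)² + (x - y)², the double sum separates in x + y and x - y. For x = 7k +
w + i and y = 7l + w - i, the two terms on the right collect the even and the odd values of k - l.
-/
theorem thetaResidue_mul_thetaResidue {ρ : ℝ} (hr : 0 < ρ) (hr1 : ρ < 1) (w i : ℤ) :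
    thetaResidue 7 (ρ ^ 2) (w + i) * thetaResidue 7 (ρ ^ 2) (w - i) =
      thetaResidue 14 ρ (2 * w) * thetaResidue 14 ρ (2 * i) +
      thetaResidue 14 ρ (2 * w + 7) * thetaResidue 14 ρ (2 * i + 7) := by
  have h7 : (7 : ℤ) ≠ 0 := by norm_num
  have h14 : (14 : ℤ) ≠ 0 := by norm_num
  have hρ : 0 < ρ ^ 2 := pow_pos hr 2
  have hρ1 : ρ ^ 2 < 1 := pow_lt_one₀ hr.le hr1 (by norm_num)
  have ha := hasSum_thetaResidue h7 hρ hρ1 (w + i)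
  have hb := hasSum_thetaResidue h7 hρ hρ1 (w - i)
  have hab := hasSum_mul_prod_of_nonneg ha hb (fun n => by positivity)
    fun n => by positivity
  let e : ℤ × ℤ ≃ ℤ × ℤ :=
    { toFun := fun v => (v.2 + v.1, v.2)
      invFun := fun v => (v.1 - v.2, v.2)
      left_inv := fun v => by ext <;> simp
      right_inv := fun v => by ext <;> simp }
  rw [← e.hasSum_iff] at hab
  have hfib := hab.prod_fiberwise fun b => (hab.summable.prod_factor b).hasSum
  have hE := (hasSum_thetaResidue h14 hr hr1 (2 * i)).mul_left (thetaResidue 14 ρ (2 * w))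
  have hO := (hasSum_thetaResidue h14 hr hr1 (2 * i + 7)).mul_left
    (thetaResidue 14 ρ (2 * w + 7))
  refine hfib.unique (hasSum_int_even_add_odd (hE.congr_fun fun d => ?_)
    (hO.congr_fun fun d => ?_))
  · rw [← (Equiv.subRight d).tsum_eq, thetaResidue, ← tsum_mul_right]
    refine tsum_congr fun s => ?_
    simp only [Function.comp_apply, e, Equiv.coe_fn_mk, Equiv.subRight_apply, ← zpow_natCast ρ 2,
      ← zpow_mul, ← zpow_add₀ hr.ne']
    congr 1
    push_cast
    ring
  · rw [← (Equiv.subRight d).tsum_eq, thetaResidue, ← tsum_mul_right]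
    refine tsum_congr fun s => ?_
    simp only [Function.comp_apply, e, Equiv.coe_fn_mk, Equiv.subRight_apply, ← zpow_natCast ρ 2,
      ← zpow_mul, ← zpow_add₀ hr.ne']
    congr 1
    push_cast
    ring

theorem thetaResidue_seven_four (r : ℝ) : thetaResidue 7 r 4 = thetaResidue 7 r 3 := by
  rw [← thetaResidue_neg]; exact thetaResidue_congr r (by decide)

theorem thetaResidue_seven_five (r : ℝ) : thetaResidue 7 r 5 = thetaResidue 7 r 2 := by
  rw [← thetaResidue_neg]; exact thetaResidue_congr r (by decide)

theorem thetaResidue_seven_six (r : ℝ) : thetaResidue 7 r 6 = thetaResidue 7 r 1 := by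
  rw [← thetaResidue_neg]; exact thetaResidue_congr r (by decide)

theorem ramanujanPhi_eq_seven_dissection {r : ℝ} (hr : 0 < r) (hr1 : r < 1) :
    ramanujanPhi r = thetaResidue 7 r 0 + 2 * thetaResidue 7 r 1 + 2 * thetaResidue 7 r 2 +
      2 * thetaResidue 7 r 3 := by
  rw [ramanujanPhi_eq_sum_thetaResidue (N := 7) (by norm_num) hr hr1]
  simp only [Finset.sum_range_succ, Finset.sum_range_zero, Nat.cast_ofNat, Nat.cast_zero,
    Nat.cast_one, thetaResidue_seven_four, thetaResidue_seven_five, thetaResidue_seven_six]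
  ring

theorem ramanujanPhi_pow_four {r : ℝ} (hr : 0 < r) (hr1 : r < 1) {a₀ a₁ a₂ a₃ : ℝ}
    (h₀ : thetaResidue 7 r 0 = a₀) (h₁ : thetaResidue 7 r 1 = a₁)
    (h₂ : thetaResidue 7 r 2 = a₂) (h₃ : thetaResidue 7 r 3 = a₃) :
    ramanujanPhi (r ^ 7) ^ 4 =
      a₀ ^ 4 + 24 * a₀ * a₁ * a₂ * a₃ + 8 * (a₁ ^ 3 * a₂ + a₂ ^ 3 * a₃ + a₃ ^ 3 * a₁) := by
  rw [ramanujanPhi_pow_four_eq_sum hr hr1]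
  have hred : ∀ n : ℤ, thetaResidue 7 r n = thetaResidue 7 r (n % 7) := fun n =>
    thetaResidue_congr r (Int.mod_modEq n 7).symm
  have h : ∀ s t : ℕ, thetaResidue 7 r s * (thetaResidue 7 r t *
        (thetaResidue 7 r (3 * s + 2 * t) * thetaResidue 7 r (2 * s - 3 * t))) =
      thetaResidue 7 r s * (thetaResidue 7 r t *
        (thetaResidue 7 r ((3 * s + 2 * t) % 7) * thetaResidue 7 r ((2 * s - 3 * t) % 7))) := by
    intro s t
    rw [← hred, ← hred]
  simp only [h, Finset.sum_range_succ, Finset.sum_range_zero, Nat.cast_ofNat, Nat.cast_zero,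
    Nat.cast_one, Int.reduceMul, Int.reduceAdd, Int.reduceSub, Int.reduceMod, mul_zero, mul_one,
    zero_sub, sub_zero, add_zero, zero_add, Int.reduceNeg,
    EuclideanDomain.zero_mod, thetaResidue_seven_four, thetaResidue_seven_five,
    thetaResidue_seven_six, h₀, h₁, h₂, h₃]
  ring

theorem det_three_of_rank_two {x₁ x₂ x₃ y₁ y₂ y₃ u₁ u₂ u₃ v₁ v₂ v₃ : ℝ}
    {m₁₁ m₁₂ m₁₃ m₂₁ m₂₂ m₂₃ m₃₁ m₃₂ m₃₃ : ℝ}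
    (h₁₁ : m₁₁ = x₁ * u₁ + y₁ * v₁) (h₁₂ : m₁₂ = x₁ * u₂ + y₁ * v₂)
    (h₁₃ : m₁₃ = x₁ * u₃ + y₁ * v₃) (h₂₁ : m₂₁ = x₂ * u₁ + y₂ * v₁)
    (h₂₂ : m₂₂ = x₂ * u₂ + y₂ * v₂) (h₂₃ : m₂₃ = x₂ * u₃ + y₂ * v₃)
    (h₃₁ : m₃₁ = x₃ * u₁ + y₃ * v₁) (h₃₂ : m₃₂ = x₃ * u₂ + y₃ * v₂)
    (h₃₃ : m₃₃ = x₃ * u₃ + y₃ * v₃) :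
    m₁₁ * (m₂₂ * m₃₃ - m₂₃ * m₃₂) - m₁₂ * (m₂₁ * m₃₃ - m₂₃ * m₃₁) +
      m₁₃ * (m₂₁ * m₃₂ - m₂₂ * m₃₁) = 0 := by
  subst_vars
  ring

/-- Two algebraic relations between the theta series of residues modulo seven. -/
theorem thetaResidue_seven_relations {r : ℝ} (hr : 0 < r) (hr1 : r < 1) {a₀ a₁ a₂ a₃ W : ℝ}
    (h₀ : thetaResidue 7 r 0 = a₀) (h₁ : thetaResidue 7 r 1 = a₁)
    (h₂ : thetaResidue 7 r 2 = a₂) (h₃ : thetaResidue 7 r 3 = a₃)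
    (hW : ramanujanPhi (r ^ 7) ^ 4 = W) :
    a₀ ^ 3 * (a₁ * a₂ * a₃) + 2 * (a₁ * a₂ * a₃) ^ 2 =
        a₀ * (a₁ ^ 2 * a₂ ^ 3 + a₂ ^ 2 * a₃ ^ 3 + a₃ ^ 2 * a₁ ^ 3) ∧
      a₀ * W ^ 2 - (2 * a₀ ^ 5 + 40 * a₀ ^ 2 * (a₁ * a₂ * a₃)) * W +
        (a₀ ^ 3 - 8 * (a₁ * a₂ * a₃)) ^ 3 = 0 := by
  obtain ⟨ρ, hρ, hρr⟩ : ∃ ρ : ℝ, 0 < ρ ∧ ρ ^ 2 = r := ⟨√r, sqrt_pos.2 hr, sq_sqrt hr.le⟩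
  have hρ1 : ρ < 1 := by
    by_contra! h
    nlinarith
  have hm : ∀ w i : ℤ, thetaResidue 7 r ((w + i) % 7) * thetaResidue 7 r ((w - i) % 7) =
      thetaResidue 14 ρ (2 * w) * thetaResidue 14 ρ (2 * i) +
      thetaResidue 14 ρ (2 * w + 7) * thetaResidue 14 ρ (2 * i + 7) := by
    intro w i
    rw [← thetaResidue_mul_thetaResidue hρ hρ1, hρr,
      thetaResidue_congr r (Int.mod_modEq (w + i) 7), thetaResidue_congr r (Int.mod_modEq (w - i) 7)]
  set E : ℤ → ℝ := fun w => thetaResidue 14 ρ (2 * w) with hE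
  set O : ℤ → ℝ := fun w => thetaResidue 14 ρ (2 * w + 7) with hO
  have hm' : ∀ w i x y : ℤ, (w + i) % 7 = x → (w - i) % 7 = y →
      thetaResidue 7 r x * thetaResidue 7 r y = E w * E i + O w * O i := by
    rintro w i x y rfl rfl
    exact hm w i
  have m00 := hm' 0 0 0 0 rfl rfl
  have m01 := hm' 0 1 1 6 rfl rfl
  have m02 := hm' 0 2 2 5 rfl rfl
  have m03 := hm' 0 3 3 4 rfl rfl
  have m10 := hm' 1 0 1 1 rfl rfl
  have m11 := hm' 1 1 2 0 rfl rfl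
  have m12 := hm' 1 2 3 6 rfl rfl
  have m13 := hm' 1 3 4 5 rfl rfl
  have m20 := hm' 2 0 2 2 rfl rfl
  have m21 := hm' 2 1 3 1 rfl rfl
  have m22 := hm' 2 2 4 0 rfl rfl
  have m23 := hm' 2 3 5 6 rfl rfl
  have m30 := hm' 3 0 3 3 rfl rfl
  have m31 := hm' 3 1 4 2 rfl rfl
  have m32 := hm' 3 2 5 1 rfl rfl
  have m33 := hm' 3 3 6 0 rfl rfl
  simp only [thetaResidue_seven_four, thetaResidue_seven_five, thetaResidue_seven_six,
    h₀, h₁, h₂, h₃] at m00 m01 m02 m03 m10 m11 m12 m13 m20 m21 m22 m23 m30 m31 m32 m33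
  -- The 4 × 4 matrix with entries a_{w+i}a_{w-i} equals EEᵀ + OOᵀ, so all its 3 × 3 minors vanish.
  -- The first relation is the minor on the indices 1, 2, 3.
  have d₁ := det_three_of_rank_two m11 m12 m13 m21 m22 m23 m31 m32 m33
  have d₂ := det_three_of_rank_two m00 m01 m02 m10 m11 m12 m20 m21 m22
  have d₃ := det_three_of_rank_two m00 m01 m03 m10 m11 m13 m20 m21 m23
  have d₄ := det_three_of_rank_two m00 m02 m03 m10 m12 m13 m20 m22 m23
  have d₅ := det_three_of_rank_two m01 m02 m03 m11 m12 m13 m21 m22 m23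
  have d₆ := det_three_of_rank_two m00 m01 m03 m10 m11 m13 m30 m31 m33
  have d₇ := det_three_of_rank_two m00 m02 m03 m10 m12 m13 m30 m32 m33
  clear_value E O
  clear m00 m01 m02 m03 m10 m11 m12 m13 m20 m21 m22 m23 m30 m31 m32 m33 hm hm'
  refine ⟨by linear_combination d₁, ?_⟩
  rw [← hW, ramanujanPhi_pow_four hr hr1 h₀ h₁ h₂ h₃]
  -- Once the quartic form is substituted for W, the second relation lies in the ideal generated by
  -- the minors.
  linear_combination -192 * a₂ * a₃ ^ 2 * d₂ - 64 * a₁ * a₃ ^ 2 * d₃ - 128 * a₀ * a₂ * a₃ * d₄ -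
    64 * a₀ * a₃ ^ 2 * d₅ - 64 * a₀ ^ 2 * a₃ * d₆ - 64 * a₁ ^ 3 * d₇

/-! ### Infinite products and the Jacobi triple product. -/

open Filter Topology in
theorem tendsto_prod_qPochhammerInf (a : ℝ) {q : ℝ} (hq : 0 < q) (hq1 : q < 1) :
    Tendsto (fun n => ∏ k ∈ Finset.range n, (1 - a * q ^ k)) atTop (𝓝 (qPochhammerInf a q)) := by
  have h : Multipliable fun k : ℕ => 1 - a * q ^ k := by
    have := Real.multipliable_one_add_of_summable (f := fun k : ℕ => -(a * q ^ k))
      ((summable_geometric_of_lt_one hq.le hq1).mul_left a).neg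
    simpa [sub_eq_add_neg] using this
  exact h.tendsto_prod_tprod_nat

theorem qPochhammerInf_ne_zero {a q : ℝ} (hq : 0 < q) (hq1 : q < 1)
    (h : ∀ k : ℕ, 1 - a * q ^ k ≠ 0) : qPochhammerInf a q ≠ 0 := by
  have := tprod_one_add_ne_zero_of_summable (f := fun k : ℕ => -(a * q ^ k))
    (fun k => by simpa [sub_eq_add_neg] using h k)
    ((summable_geometric_of_lt_one hq.le hq1).mul_left a).neg.norm
  simpa [sub_eq_add_neg, qPochhammerInf] using this

theorem qPochhammerInf_pos {a q : ℝ} (hq : 0 < q) (hq1 : q < 1) (ha : a < 1) :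
    0 < qPochhammerInf a q := by
  have hf : ∀ k : ℕ, 0 < 1 - a * q ^ k := fun k => by
    have h1 : 0 < q ^ k := pow_pos hq k
    have h2 : q ^ k ≤ 1 := pow_le_one₀ hq.le hq1.le
    nlinarith
  refine lt_of_le_of_ne ?_ (qPochhammerInf_ne_zero hq hq1 fun k => (hf k).ne').symm
  exact ge_of_tendsto' (tendsto_prod_qPochhammerInf a hq hq1) fun n =>
    Finset.prod_nonneg fun k _ => (hf k).le

/-- The Gaussian binomial coefficient. -/
def gaussBinom (q : ℝ) : ℕ → ℕ → ℝ
  | _, 0 => 1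
  | 0, _ + 1 => 0
  | n + 1, k + 1 => gaussBinom q n (k + 1) + q ^ (n - k) * gaussBinom q n k

theorem gaussBinom_zero_right (q : ℝ) (n : ℕ) : gaussBinom q n 0 = 1 := by
  cases n <;> rfl

theorem gaussBinom_eq_zero (q : ℝ) : ∀ {n k : ℕ}, n < k → gaussBinom q n k = 0
  | 0, _ + 1, _ => rfl
  | n + 1, k + 1, h => by
    rw [gaussBinom, gaussBinom_eq_zero q (by omega : n < k + 1),
      gaussBinom_eq_zero q (by omega : n < k)]
    ring

/-- The quotient formula for Gaussian binomials with denominators cleared. It later supplies both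
their limit and a uniform bound. -/
theorem gaussBinom_mul (q : ℝ) (m k : ℕ) :
    gaussBinom q (m + k) k * ((∏ i ∈ Finset.range k, (1 - q ^ (i + 1))) *
      ∏ i ∈ Finset.range m, (1 - q ^ (i + 1))) = ∏ i ∈ Finset.range (m + k), (1 - q ^ (i + 1)) := by
  induction hn : m + k using Nat.strong_induction_on generalizing m k with
  | _ n ih =>
    subst hn
    rcases k with _ | k
    · simp [gaussBinom_zero_right]
    rcases m with _ | m
    · have h1 := ih (0 + k) (by omega) 0 k rfl
      rw [show 0 + (k + 1) = k + 1 by ring, gaussBinom, gaussBinom_eq_zero q (by omega)]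
      simp only [zero_add, Finset.prod_range_zero, mul_one, Nat.sub_self, pow_zero, one_mul] at h1 ⊢
      rw [Finset.prod_range_succ, ← mul_assoc, h1]
    · have h1 := ih (m + (k + 1)) (by omega) m (k + 1) rfl
      have h2 := ih (m + 1 + k) (by omega) (m + 1) k rfl
      rw [show m + (k + 1) = m + 1 + k by ring] at h1
      rw [show m + 1 + (k + 1) = m + 1 + k + 1 by ring, gaussBinom,
        show m + 1 + k - k = m + 1 by omega, Finset.prod_range_succ (n := m + 1 + k)]
      rw [Finset.prod_range_succ (n := k), Finset.prod_range_succ (n := m)]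
      rw [Finset.prod_range_succ (n := k)] at h1
      rw [Finset.prod_range_succ (n := m)] at h2
      rw [pow_succ q (m + 1 + k), pow_add q (m + 1) k]
      linear_combination (1 - q ^ (m + 1)) * h1 + q ^ (m + 1) * (1 - q ^ (k + 1)) * h2

theorem prod_one_add_mul_pow (q x : ℝ) (n : ℕ) :
    ∏ k ∈ Finset.range n, (1 + x * q ^ k) =
      ∑ j ∈ Finset.range (n + 1), gaussBinom q n j * q ^ (j.choose 2) * x ^ j := by
  induction n with
  | zero => simp [gaussBinom_zero_right]
  | succ n ih =>
    rw [Finset.prod_range_succ, ih, mul_add, mul_one, Finset.sum_range_succ' _ (n + 1)]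
    have h : ∀ j ∈ Finset.range (n + 1),
        gaussBinom q (n + 1) (j + 1) * q ^ ((j + 1).choose 2) * x ^ (j + 1) =
        gaussBinom q n (j + 1) * q ^ ((j + 1).choose 2) * x ^ (j + 1) +
        gaussBinom q n j * q ^ (j.choose 2) * x ^ j * (x * q ^ n) := by
      intro j hj
      have hjn : j ≤ n := by simpa [Nat.lt_succ_iff] using hj
      obtain ⟨d, rfl⟩ := Nat.exists_eq_add_of_le hjn
      have e : (j + 1).choose 2 = j + j.choose 2 := by
        rw [Nat.choose_succ_succ' j 1, Nat.choose_one_right]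
      rw [gaussBinom, show j + d - j = d by omega, e, pow_add q j, pow_add q j, pow_succ x]
      ring
    rw [Finset.sum_congr rfl h, Finset.sum_add_distrib, ← Finset.sum_mul]
    have e2 := Finset.sum_range_succ' (fun j => gaussBinom q n j * q ^ (j.choose 2) * x ^ j) (n + 1)
    rw [Finset.sum_range_succ, gaussBinom_eq_zero q (Nat.lt_succ_self n)] at e2
    simp only [gaussBinom_zero_right] at e2 ⊢
    linear_combination e2

theorem prod_jacobi_finite {q z : ℝ} (hq : 0 < q) (hz : z ≠ 0) (n : ℕ) :
    ∏ k ∈ Finset.range n, ((1 + q * z * (q ^ 2) ^ k) * (1 + q / z * (q ^ 2) ^ k)) =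
      ∑ j ∈ Finset.range (2 * n + 1), gaussBinom (q ^ 2) (2 * n) j *
        (q ^ (((j : ℤ) - n) ^ 2) * z ^ ((j : ℤ) - n)) := by
  have hq0 := hq.ne'
  -- The shift q^(1-2n) centres the 2n factors: their exponents run over the odd numbers from 1 - 2n
  -- to 2n - 1. The lower half, reversed, yields the factors in q/z.
  have h := prod_one_add_mul_pow (q ^ 2) (z * q ^ (1 - 2 * n : ℤ)) (2 * n)
  have h2 : ∏ k ∈ Finset.range (2 * n), (1 + z * q ^ (1 - 2 * n : ℤ) * (q ^ 2) ^ k) =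
      (z ^ n * q ^ (-(n : ℤ) ^ 2)) *
      ∏ k ∈ Finset.range n, ((1 + q * z * (q ^ 2) ^ k) * (1 + q / z * (q ^ 2) ^ k)) := by
    have hP : z ^ n * q ^ (-(n : ℤ) ^ 2) =
        ∏ k ∈ Finset.range n, (z * q ^ (-(2 * k + 1) : ℤ)) := by
      clear h
      induction n with
      | zero => simp
      | succ n ih =>
        rw [Finset.prod_range_succ, ← ih, mul_mul_mul_comm, ← zpow_add₀ hq0, pow_succ]
        congr 2
        push_cast; ring
    rw [two_mul, Finset.prod_range_add, ← Finset.prod_range_reflect, hP, ← Finset.prod_mul_distrib,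
      ← Finset.prod_mul_distrib]
    refine Finset.prod_congr rfl fun k hk => ?_
    have hk' := Finset.mem_range.1 hk
    have e1 : z * q ^ (1 - 2 * n : ℤ) * (q ^ 2) ^ (n - 1 - k) = z * q ^ (-(2 * k + 1) : ℤ) := by
      rw [mul_assoc, ← pow_mul, ← zpow_natCast, ← zpow_add₀ hq0]
      congr 2
      push_cast [show k ≤ n - 1 by omega, show 1 ≤ n by omega]
      ring
    have e2 : z * q ^ (1 - 2 * n : ℤ) * (q ^ 2) ^ (n + k) = q * z * (q ^ 2) ^ k := by
      rw [mul_assoc, ← pow_mul, ← zpow_natCast, ← zpow_add₀ hq0, mul_comm q z, mul_assoc, ← pow_mul,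
        ← pow_succ', ← zpow_natCast q (2 * k + 1)]
      congr 2
      push_cast
      ring
    have e3 : z * q ^ (-(2 * k + 1) : ℤ) * (q / z * (q ^ 2) ^ k) = 1 := by
      have : q ^ (-(2 * k + 1) : ℤ) = (q * (q ^ 2) ^ k)⁻¹ := by
        rw [zpow_neg, ← pow_mul, ← pow_succ', ← zpow_natCast q (2 * k + 1)]
        push_cast; rfl
      rw [this]
      field_simp
    rw [e1, e2]
    linear_combination -(1 + q * z * (q ^ 2) ^ k) * e3
  rw [h2] at h
  have hc : z ^ n * q ^ (-(n : ℤ) ^ 2) ≠ 0 := by positivity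
  rw [← mul_right_inj' hc, h, Finset.mul_sum]
  refine Finset.sum_congr rfl fun j _ => ?_
  have e1 : (q ^ 2) ^ (j.choose 2) * (z * q ^ (1 - 2 * n : ℤ)) ^ j =
      z ^ n * q ^ (-(n : ℤ) ^ 2) * (q ^ (((j : ℤ) - n) ^ 2) * z ^ ((j : ℤ) - n)) := by
    have hj : ((2 * j.choose 2 : ℕ) : ℤ) = j * (j - 1) := by
      have := Nat.choose_two_right j
      have h3 : 2 * (j * (j - 1) / 2) = j * (j - 1) :=
        Nat.mul_div_cancel' (Nat.even_mul_pred_self j).two_dvd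
      rw [this, h3]
      rcases j with _ | j <;> simp
    rw [mul_pow, ← pow_mul, ← zpow_natCast q, hj, ← zpow_natCast (q ^ (1 - 2 * n : ℤ)), ← zpow_mul,
      ← zpow_natCast z n, ← zpow_natCast z j]
    rw [show q ^ ((j : ℤ) * (j - 1)) * (z ^ (j : ℤ) * q ^ ((1 - 2 * n) * j : ℤ)) =
      z ^ (j : ℤ) * (q ^ ((j : ℤ) * (j - 1)) * q ^ ((1 - 2 * n) * j : ℤ)) by ring,
      show z ^ (n : ℤ) * q ^ (-(n : ℤ) ^ 2) * (q ^ (((j : ℤ) - n) ^ 2) * z ^ ((j : ℤ) - n)) =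
      (z ^ (n : ℤ) * z ^ ((j : ℤ) - n)) * (q ^ (-(n : ℤ) ^ 2) * q ^ (((j : ℤ) - n) ^ 2)) by ring,
      ← zpow_add₀ hq0, ← zpow_add₀ hq0, ← zpow_add₀ hz]
    congr 2 <;> ring
  rw [mul_assoc, e1]
  ring

open Filter Topology in
/-- **Jacobi's triple product identity.** -/
theorem jacobi_triple_product {q z : ℝ} (hq : 0 < q) (hq1 : q < 1) (hz : z ≠ 0) :
    ∑' n : ℤ, q ^ (n ^ 2) * z ^ n = qPochhammerInf (q ^ 2) (q ^ 2) *
      (qPochhammerInf (-(q * z)) (q ^ 2) * qPochhammerInf (-(q / z)) (q ^ 2)) := by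
  have hQ : 0 < q ^ 2 := pow_pos hq 2
  have hQ1 : q ^ 2 < 1 := pow_lt_one₀ hq.le hq1 (by norm_num)
  set L := qPochhammerInf (q ^ 2) (q ^ 2) with hLdef
  have hL : 0 < L := qPochhammerInf_pos hQ hQ1 hQ1
  set D : ℕ → ℝ := fun n => ∏ i ∈ Finset.range n, (1 - (q ^ 2) ^ (i + 1)) with hD
  have hDL : Tendsto D atTop (𝓝 L) := by
    refine (tendsto_prod_qPochhammerInf (q ^ 2) hQ hQ1).congr fun n => ?_
    exact Finset.prod_congr rfl fun k _ => by rw [pow_succ' (q ^ 2) k]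
  have hfac : ∀ i : ℕ, 0 < 1 - (q ^ 2) ^ (i + 1) := fun i =>
    sub_pos.2 (pow_lt_one₀ hQ.le hQ1 (by omega))
  have hDpos : ∀ n, 0 < D n := fun n => Finset.prod_pos fun i _ => hfac i
  have hanti : Antitone D := antitone_nat_of_succ_le fun n => by
    simp only [hD]
    rw [Finset.prod_range_succ]
    exact mul_le_of_le_one_right (hDpos n).le (by linarith [pow_pos hQ (n + 1)])
  have hDge : ∀ n, L ≤ D n := fun n => hanti.le_of_tendsto hDL n
  have hDle : ∀ n, D n ≤ 1 := fun n => by simpa [hD] using hanti (Nat.zero_le n)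
  have hgb : ∀ m k, gaussBinom (q ^ 2) (m + k) k = D (m + k) / (D k * D m) := fun m k => by
    rw [eq_div_iff (mul_pos (hDpos k) (hDpos m)).ne']
    exact gaussBinom_mul (q ^ 2) m k
  have hgb0 : ∀ n k, 0 ≤ gaussBinom (q ^ 2) n k ∧ gaussBinom (q ^ 2) n k ≤ 1 / (L * L) := by
    intro n k
    rcases lt_or_ge n k with h | h
    · rw [gaussBinom_eq_zero _ h]
      exact ⟨le_rfl, by positivity⟩
    · obtain ⟨m, rfl⟩ := Nat.exists_eq_add_of_le' h
      rw [hgb]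
      refine ⟨(div_pos (hDpos _) (mul_pos (hDpos k) (hDpos m))).le, ?_⟩
      exact div_le_div₀ zero_le_one (hDle _) (mul_pos hL hL)
        (mul_le_mul (hDge k) (hDge m) hL.le (hDpos k).le)
  -- The finite sum is extended by zero to all integers. The condition cuts off i < -n, where
  -- `toNat` would give the junk value 0; for i > n the Gaussian binomial itself vanishes.
  set F : ℕ → ℤ → ℝ := fun n i => if -(n : ℤ) ≤ i then
    gaussBinom (q ^ 2) (2 * n) (i + n).toNat * (q ^ (i ^ 2) * z ^ i) else 0 with hF
  have hsum : ∀ n : ℕ, ∑' i, F n i =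
      ∏ k ∈ Finset.range n, ((1 + q * z * (q ^ 2) ^ k) * (1 + q / z * (q ^ 2) ^ k)) := by
    intro n
    rw [prod_jacobi_finite hq hz]
    have hinj : Function.Injective fun j : ℕ => (j : ℤ) - n := fun a b h => by simpa using h
    refine HasSum.tsum_eq ((hinj.hasSum_iff fun i hi => ?_).1 ?_)
    · refine if_neg fun h => hi ⟨(i + n).toNat, ?_⟩
      change ((i + n).toNat : ℤ) - n = i
      omega
    · refine (hasSum_sum_of_ne_finset_zero (s := Finset.range (2 * n + 1)) (f := fun j : ℕ =>
        gaussBinom (q ^ 2) (2 * n) j * (q ^ (((j : ℤ) - n) ^ 2) * z ^ ((j : ℤ) - n)))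
        fun j hj => ?_).congr_fun fun j => ?_
      · rw [gaussBinom_eq_zero _ (by simpa using hj), zero_mul]
      · simp [hF]
  have hlim : Tendsto (fun n => ∑' i, F n i) atTop
      (𝓝 (∑' i : ℤ, 1 / L * (q ^ (i ^ 2) * z ^ i))) := by
    refine tendsto_tsum_of_dominated_convergence
      (bound := fun i : ℤ => 1 / (L * L) * (q ^ (i ^ 2) * |z| ^ i)) ?_ ?_ ?_
    · exact (summable_zpow_sq_mul_zpow hq hq1 (abs_pos.2 hz)).mul_left _
    · intro i
      have h1 : Tendsto (fun n : ℕ => D (2 * n) / (D (i + n).toNat * D ((n : ℤ) - i).toNat) *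
          (q ^ (i ^ 2) * z ^ i)) atTop (𝓝 (L / (L * L) * (q ^ (i ^ 2) * z ^ i))) := by
        refine Tendsto.mul_const _ ((hDL.comp ?_).div ((hDL.comp ?_).mul (hDL.comp ?_))
          (mul_pos hL hL).ne')
        · exact tendsto_id.const_mul_atTop' (by norm_num)
        · exact tendsto_atTop_atTop.2 fun b => ⟨b + i.natAbs, fun n hn => by omega⟩
        · exact tendsto_atTop_atTop.2 fun b => ⟨b + i.natAbs, fun n hn => by omega⟩
      rw [show L / (L * L) = 1 / L by field_simp] at h1
      refine h1.congr' ?_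
      filter_upwards [eventually_ge_atTop i.natAbs] with n hn
      simp only [hF]
      rw [if_pos (by omega)]
      have e : 2 * n = ((n : ℤ) - i).toNat + (i + n).toNat := by omega
      rw [e, hgb]
    · refine Eventually.of_forall fun n i => ?_
      have hb : ‖q ^ (i ^ 2) * z ^ i‖ = q ^ (i ^ 2) * |z| ^ i := by
        rw [norm_mul, norm_zpow, norm_zpow, Real.norm_eq_abs, Real.norm_eq_abs, abs_of_pos hq]
      simp only [hF]
      split_ifs
      · rw [norm_mul, hb, Real.norm_eq_abs, abs_of_nonneg (hgb0 _ _).1]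
        exact mul_le_mul_of_nonneg_right (hgb0 _ _).2 (by positivity)
      · rw [norm_zero]; positivity
  have hprod : Tendsto (fun n => ∑' i, F n i) atTop
      (𝓝 (qPochhammerInf (-(q * z)) (q ^ 2) * qPochhammerInf (-(q / z)) (q ^ 2))) := by
    refine ((tendsto_prod_qPochhammerInf (-(q * z)) hQ hQ1).mul
      (tendsto_prod_qPochhammerInf (-(q / z)) hQ hQ1)).congr fun n => ?_
    rw [hsum, ← Finset.prod_mul_distrib]
    refine Finset.prod_congr rfl fun k _ => ?_
    ring
  rw [← tendsto_nhds_unique hlim hprod, tsum_mul_left]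
  field_simp

/-! ### Product formulas for φ, χ and the theta constants. -/

open Filter Topology in
/-- Euler's product identity, in the form `χ(q) χ(-q) (-q²; q²)_∞ = 1`. -/
theorem ramanujanChi_mul_mul {q : ℝ} (hq : 0 < q) (hq1 : q < 1) :
    ramanujanChi q * qPochhammerInf q (q ^ 2) * qPochhammerInf (-q ^ 2) (q ^ 2) = 1 := by
  have hQ : 0 < q ^ 2 := pow_pos hq 2
  have hQ1 : q ^ 2 < 1 := pow_lt_one₀ hq.le hq1 (by norm_num)
  have hL := qPochhammerInf_pos hQ hQ1 hQ1
  have hC := tendsto_prod_qPochhammerInf (-q) hQ hQ1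
  have hS := tendsto_prod_qPochhammerInf q hQ hQ1
  have hR := tendsto_prod_qPochhammerInf (-q ^ 2) hQ hQ1
  have hD := tendsto_prod_qPochhammerInf (q ^ 2) hQ hQ1
  have h2 : Tendsto (fun n : ℕ => 2 * n) atTop atTop :=
    tendsto_id.const_mul_atTop' (by norm_num)
  have hlim := ((hC.mul hS).mul hR).mul hD
  -- After multiplication by (q²; q²), the pairs 1 ± q^(2k+1) and 1 ± q^(2k+2) give the factors 1 -
  -- q^(4k+2) and 1 - q^(4k+4), which interlace into a partial product of (q²; q²) of double length.
  have heq : ∀ n : ℕ, (∏ k ∈ Finset.range n, (1 - -q * (q ^ 2) ^ k)) *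
      (∏ k ∈ Finset.range n, (1 - q * (q ^ 2) ^ k)) *
      (∏ k ∈ Finset.range n, (1 - -q ^ 2 * (q ^ 2) ^ k)) *
      (∏ k ∈ Finset.range n, (1 - q ^ 2 * (q ^ 2) ^ k)) =
      ∏ k ∈ Finset.range (2 * n), (1 - q ^ 2 * (q ^ 2) ^ k) := by
    intro n
    induction n with
    | zero => simp
    | succ n ih =>
      rw [show 2 * (n + 1) = 2 * n + 1 + 1 by ring]
      simp only [Finset.prod_range_succ]
      rw [← ih]
      ring
  have h := tendsto_nhds_unique (hlim.congr heq) (hD.comp h2)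
  exact mul_right_cancel₀ hL.ne' (h.trans (one_mul _).symm)

theorem ramanujanPhi_eq_product {q : ℝ} (hq : 0 < q) (hq1 : q < 1) :
    ramanujanPhi q = qPochhammerInf (q ^ 2) (q ^ 2) * ramanujanChi q ^ 2 := by
  have h := jacobi_triple_product hq hq1 one_ne_zero
  simp only [one_zpow, mul_one, div_one] at h
  rw [ramanujanPhi, h, ramanujanChi, sq (qPochhammerInf _ _)]

theorem hasSum_ramanujanPhi {q : ℝ} (hq : 0 < q) (hq1 : q < 1) :
    HasSum (fun n : ℤ => q ^ (n ^ 2)) (ramanujanPhi q) :=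
  (summable_zpow_sq hq hq1).hasSum

theorem hasSum_ramanujanPhi_odd {q : ℝ} (hq : 0 < q) (hq1 : q < 1) :
    HasSum (fun n : ℤ => q ^ ((2 * n + 1) ^ 2)) (ramanujanPhi q - ramanujanPhi (q ^ 4)) := by
  have he := hasSum_ramanujanPhi (pow_pos hq 4) (pow_lt_one₀ hq.le hq1 (by norm_num))
  have ho := hasSum_thetaResidue two_ne_zero hq hq1 1
  have h : ramanujanPhi q = _ := (hasSum_ramanujanPhi hq hq1).unique (hasSum_int_even_add_odd
    (he.congr_fun fun n => by
      rw [← zpow_natCast q 4, ← zpow_mul]; congr 1; push_cast; ring) ho)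
  rw [h, add_sub_cancel_left]
  exact ho

theorem tsum_alternating_eq {q : ℝ} (hq : 0 < q) (hq1 : q < 1) :
    ∑' n : ℤ, q ^ (n ^ 2) * (-1) ^ n = 2 * ramanujanPhi (q ^ 4) - ramanujanPhi q := by
  have he := hasSum_ramanujanPhi (pow_pos hq 4) (pow_lt_one₀ hq.le hq1 (by norm_num))
  have ho := (hasSum_ramanujanPhi_odd hq hq1).neg
  have h := hasSum_int_even_add_odd (f := fun n : ℤ => q ^ (n ^ 2) * (-1) ^ n)
    (he.congr_fun fun n => by
      rw [Even.neg_one_zpow (even_two_mul n), mul_one, ← zpow_natCast q 4, ← zpow_mul]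
      congr 1; push_cast; ring)
    (ho.congr_fun fun n => by
      rw [Odd.neg_one_zpow (odd_two_mul_add_one n), mul_neg_one])
  rw [h.tsum_eq]
  ring

theorem qPochhammerInf_neg_one {q : ℝ} (hq : 0 < q) (hq1 : q < 1) :
    qPochhammerInf (-1) q = 2 * qPochhammerInf (-q) q := by
  have h1 := (tendsto_prod_qPochhammerInf (-1) hq hq1).comp (Filter.tendsto_add_atTop_nat 1)
  refine tendsto_nhds_unique h1
    (((tendsto_prod_qPochhammerInf (-q) hq hq1).const_mul 2).congr fun n => ?_)
  rw [Function.comp_apply, Finset.prod_range_succ']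
  have : ∏ k ∈ Finset.range n, (1 - -1 * q ^ (k + 1)) = ∏ k ∈ Finset.range n, (1 - -q * q ^ k) :=
    Finset.prod_congr rfl fun k _ => by ring
  rw [this]
  ring

/-- The relation `f⁶ = 2 θ₃² / (θ₂ θ₄)` between the Weber function and the theta constants. -/
theorem ramanujanChi_pow_six_mul {ρ : ℝ} (hρ : 0 < ρ) (hρ1 : ρ < 1) :
    ramanujanChi (ρ ^ 4) ^ 6 * (ramanujanPhi ρ - ramanujanPhi (ρ ^ 4)) *
      (2 * ramanujanPhi ((ρ ^ 4) ^ 4) - ramanujanPhi (ρ ^ 4)) =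
      2 * ρ * ramanujanPhi (ρ ^ 4) ^ 2 := by
  have hq : 0 < ρ ^ 4 := pow_pos hρ 4
  have hq1 : ρ ^ 4 < 1 := pow_lt_one₀ hρ.le hρ1 (by norm_num)
  have hθ : ramanujanPhi ρ - ramanujanPhi (ρ ^ 4) =
      ρ * ∑' n : ℤ, (ρ ^ 4) ^ (n ^ 2) * (ρ ^ 4) ^ n := by
    rw [← tsum_mul_left, ← (hasSum_ramanujanPhi_odd hρ hρ1).tsum_eq]
    refine tsum_congr fun n => ?_
    rw [← zpow_natCast ρ 4, ← zpow_mul, ← zpow_mul, ← zpow_add₀ hρ.ne', ← zpow_one_add₀ hρ.ne']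
    congr 1
    push_cast
    ring
  rw [hθ, ← tsum_alternating_eq hq hq1, ramanujanPhi_eq_product hq hq1]
  generalize ρ ^ 4 = q at *
  have hQ : 0 < q ^ 2 := pow_pos hq 2
  have hQ1 : q ^ 2 < 1 := pow_lt_one₀ hq.le hq1 (by norm_num)
  have hE := ramanujanChi_mul_mul hq hq1
  rw [jacobi_triple_product hq hq1 hq.ne', jacobi_triple_product hq hq1 (by norm_num : (-1 : ℝ) ≠ 0),
    div_self hq.ne', qPochhammerInf_neg_one hQ hQ1, ← sq q]
  simp only [mul_neg_one, div_neg, div_one, neg_neg]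
  generalize ramanujanChi q = C at *
  generalize qPochhammerInf (-q ^ 2) (q ^ 2) = R at *
  generalize qPochhammerInf q (q ^ 2) = S at *
  linear_combination 2 * ρ * C ^ 4 * qPochhammerInf (q ^ 2) (q ^ 2) ^ 2 * (C * S * R + 1) * hE

/-! ### Product formulas modulo seven. -/

open Filter Topology in
theorem ramanujanChi_seven_dissection {q : ℝ} (hq : 0 < q) (hq1 : q < 1) :
    ramanujanChi q = ∏ i ∈ Finset.range 7, qPochhammerInf (-q ^ (2 * i + 1)) (q ^ 14) := by
  have hQ : 0 < q ^ 2 := pow_pos hq 2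
  have hQ1 : q ^ 2 < 1 := pow_lt_one₀ hq.le hq1 (by norm_num)
  have h14 : 0 < q ^ 14 := pow_pos hq 14
  have h141 : q ^ 14 < 1 := pow_lt_one₀ hq.le hq1 (by norm_num)
  have h7 : Tendsto (fun n : ℕ => 7 * n) atTop atTop :=
    tendsto_id.const_mul_atTop' (by norm_num)
  have h1 := (tendsto_prod_qPochhammerInf (-q) hQ hQ1).comp h7
  have h2 := tendsto_finsetProd (Finset.range 7) fun i _ =>
    tendsto_prod_qPochhammerInf (-q ^ (2 * i + 1)) h14 h141
  refine tendsto_nhds_unique h1 (h2.congr fun n => ?_)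
  rw [Finset.prod_comm, Function.comp_apply]
  induction n with
  | zero => simp
  | succ n ih =>
    rw [Finset.prod_range_succ, ih, show 7 * (n + 1) = 7 * n + 7 by ring, Finset.prod_range_add]
    congr 1
    refine Finset.prod_congr rfl fun i _ => ?_
    ring

/-- As (7n + j)² = 49n² + 14jn + j², this is the triple product with base r^49 and z = r^(14j); the
exponents 49 ± 14j are written as 7i₁ and 7i₂. -/
theorem thetaResidue_seven_eq_product {r : ℝ} (hr : 0 < r) (hr1 : r < 1) {j i₁ i₂ : ℕ}
    (h₁ : i₁ = 7 + 2 * j) (h₂ : i₂ + 2 * j = 7) :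
    thetaResidue 7 r j = r ^ (j ^ 2) * (qPochhammerInf ((r ^ 7) ^ 14) ((r ^ 7) ^ 14) *
      (qPochhammerInf (-(r ^ 7) ^ i₁) ((r ^ 7) ^ 14) *
        qPochhammerInf (-(r ^ 7) ^ i₂) ((r ^ 7) ^ 14))) := by
  have hQ : 0 < r ^ 49 := pow_pos hr 49
  have hQ1 : r ^ 49 < 1 := pow_lt_one₀ hr.le hr1 (by norm_num)
  have hz : r ^ (14 * j) ≠ 0 := (pow_pos hr _).ne'
  have h := jacobi_triple_product hQ hQ1 hz
  have e₁ : r ^ 49 * r ^ (14 * j) = (r ^ 7) ^ i₁ := by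
    rw [h₁]; ring
  have e₂ : r ^ 49 / r ^ (14 * j) = (r ^ 7) ^ i₂ := by
    rw [div_eq_iff hz, ← pow_mul, ← pow_add]
    congr 1
    omega
  have e₃ : (r ^ 49) ^ 2 = (r ^ 7) ^ 14 := by ring
  rw [e₁, e₂, e₃] at h
  rw [← h, ← tsum_mul_left, thetaResidue]
  refine tsum_congr fun n => ?_
  rw [← zpow_natCast r 49, ← zpow_mul, ← zpow_natCast r (14 * j), ← zpow_mul, ← zpow_add₀ hr.ne',
    ← zpow_natCast r (j ^ 2), ← zpow_add₀ hr.ne']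
  congr 1
  push_cast
  ring

/-- In the dissection of χ(r^7) the middle factor is χ(r^49), and the other six pair up into the
triple products of a₁, a₂, a₃. The exponent 14 is 1 + 4 + 9. -/
theorem thetaResidue_seven_mul_mul {r : ℝ} (hr : 0 < r) (hr1 : r < 1) :
    thetaResidue 7 r 1 * thetaResidue 7 r 2 * thetaResidue 7 r 3 * ramanujanChi (r ^ 49) ^ 7 =
      r ^ 14 * ramanujanChi (r ^ 7) * thetaResidue 7 r 0 ^ 3 := by
  have p₀ := thetaResidue_seven_eq_product hr hr1 (j := 0) (i₁ := 7) (i₂ := 7) rfl rfl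
  have p₁ := thetaResidue_seven_eq_product hr hr1 (j := 1) (i₁ := 9) (i₂ := 5) rfl rfl
  have p₂ := thetaResidue_seven_eq_product hr hr1 (j := 2) (i₁ := 11) (i₂ := 3) rfl rfl
  have p₃ := thetaResidue_seven_eq_product hr hr1 (j := 3) (i₁ := 13) (i₂ := 1) rfl rfl
  have hc := ramanujanChi_seven_dissection (pow_pos hr 7) (pow_lt_one₀ hr.le hr1 (by norm_num))
  have hc' : ramanujanChi (r ^ 49) = qPochhammerInf (-(r ^ 7) ^ 7) ((r ^ 7) ^ 14) := by
    rw [ramanujanChi]; congr 1 <;> ring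
  simp only [Finset.prod_range_succ, Finset.prod_range_zero, Nat.reduceMul, Nat.reduceAdd] at hc
  push_cast at p₀ p₁ p₂ p₃
  rw [p₀, p₁, p₂, p₃, hc, hc']
  ring

/-! ### Inversion formulas. -/

theorem ramanujanPhi_exp_neg {t : ℝ} (ht : 0 < t) :
    ramanujanPhi (exp (-π * t)) = 1 / √t * ramanujanPhi (exp (-π / t)) := by
  have h := Real.tsum_exp_neg_mul_int_sq ht
  have e : ∀ s : ℝ, ramanujanPhi (exp s) = ∑' n : ℤ, exp (s * (n : ℝ) ^ 2) := fun s =>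
    tsum_congr fun n => by
      rw [exp_mul, ← rpow_intCast]; push_cast; rfl
  rw [e, e, h, sqrt_eq_rpow]

/-- Invariance of the Weber function `f = q^(-1/24) χ(q)` under `τ ↦ -1/τ`. -/
theorem ramanujanChi_pow_six_inversion {t : ℝ} (ht : 0 < t) :
    ramanujanChi (exp (-π * t)) ^ 6 * exp (-π / (4 * t)) =
      ramanujanChi (exp (-π / t)) ^ 6 * exp (-π * t / 4) := by
  have hlt : ∀ s : ℝ, 0 < s → exp (-π * s) < 1 := fun s hs => by
    rw [exp_lt_one_iff]
    nlinarith [mul_pos pi_pos hs]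
  set g : ℝ → ℝ := fun s => ramanujanPhi (exp (-π * s)) with hg
  have hinv : ∀ s : ℝ, 0 < s → g s = 1 / √s * g (1 / s) := fun s hs => by
    simp only [hg]
    rw [ramanujanPhi_exp_neg hs, mul_one_div]
  have hrel : ∀ s : ℝ, 0 < s → ramanujanChi (exp (-π * s)) ^ 6 *
      ((g (s / 4) - g s) * (2 * g (4 * s) - g s)) = 2 * exp (-π * s / 4) * g s ^ 2 := by
    intro s hs
    have h := ramanujanChi_pow_six_mul (exp_pos (-π * (s / 4))) (hlt (s / 4) (by positivity))
    have e1 : exp (-π * (s / 4)) ^ 4 = exp (-π * s) := by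
      rw [← exp_nat_mul]; congr 1; push_cast; ring
    have e2 : exp (-π * s) ^ 4 = exp (-π * (4 * s)) := by
      rw [← exp_nat_mul]; congr 1; push_cast; ring
    rw [e1, e2] at h
    simp only [hg]
    rw [← mul_assoc, h]
    ring_nf
  have ht' : 0 < 1 / t := by positivity
  have h1 := hrel t ht
  have h2 := hrel (1 / t) ht'
  have s0 : 0 < √t := sqrt_pos.2 ht
  have s4 : √(4 : ℝ) = 2 := by
    rw [show (4 : ℝ) = 2 ^ 2 by norm_num]; exact sqrt_sq (by norm_num)
  have i1 : g (t / 4) = 2 / √t * g (4 * (1 / t)) := by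
    rw [hinv (t / 4) (by positivity), sqrt_div ht.le, s4, one_div_div,
      show 1 / (t / 4) = 4 * (1 / t) by field_simp]
  have i2 : g (4 * t) = 1 / (2 * √t) * g (1 / t / 4) := by
    rw [hinv (4 * t) (by positivity), sqrt_mul (by norm_num), s4,
      show 1 / (4 * t) = 1 / t / 4 by field_simp]
  rw [i1, i2, hinv t ht] at h1
  have hgpos : 0 < g (1 / t) := ramanujanPhi_pos (exp_pos _) (hlt _ ht')
  -- Inversion exchanges θ₂ and θ₄, so up to a power of t the product θ₂θ₄ at t is X, the same
  -- product at 1/t.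
  set X := (g (1 / t / 4) - g (1 / t)) * (2 * g (4 * (1 / t)) - g (1 / t)) with hX
  have h3 : ramanujanChi (exp (-π * t)) ^ 6 * X = 2 * exp (-π * t / 4) * g (1 / t) ^ 2 := by
    rw [hX]
    generalize g (1 / t / 4) = y₁ at *
    generalize g (4 * (1 / t)) = y₂ at *
    generalize g (1 / t) = y₃ at *
    generalize exp (-π * t / 4) = y₄ at *
    generalize ramanujanChi (exp (-π * t)) = y₅ at *
    field_simp at h1
    linear_combination h1
  have hX0 : X ≠ 0 := fun h => by
    rw [h, mul_zero] at h3
    have : 0 < 2 * exp (-π * t / 4) * g (1 / t) ^ 2 := by positivity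
    linarith
  have e3 : -π * (1 / t) / 4 = -π / (4 * t) := by field_simp
  rw [e3, mul_one_div] at h2
  refine mul_right_cancel₀ hX0 ?_
  linear_combination exp (-π / (4 * t)) * h3 - exp (-π * t / 4) * h2

theorem ramanujanChi_pos {q : ℝ} (hq : 0 < q) (hq1 : q < 1) : 0 < ramanujanChi q :=
  qPochhammerInf_pos (pow_pos hq 2) (pow_lt_one₀ hq.le hq1 (by norm_num)) (by linarith)

/-! ### Cosines of multiples of π/7 and the cyclic system. -/

/-- The numbers 4cos²(kπ/7), k = 1, 2, 3, are the roots of x³ - 5x² + 6x - 1. This follows from the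
cubic for cos(π/7), obtained from cos 4θ = -cos 3θ by removing the root -1. -/
theorem cos_pi_div_seven_relations :
    0 < cos (3 * π / 7) ∧ 1 / 2 < cos (2 * π / 7) ∧ cos (2 * π / 7) < cos (π / 7) ∧
    4 * cos (π / 7) ^ 2 + 4 * cos (2 * π / 7) ^ 2 + 4 * cos (3 * π / 7) ^ 2 = 5 ∧
    (4 * cos (π / 7) ^ 2) * (4 * cos (2 * π / 7) ^ 2) +
      (4 * cos (2 * π / 7) ^ 2) * (4 * cos (3 * π / 7) ^ 2) +
      (4 * cos (3 * π / 7) ^ 2) * (4 * cos (π / 7) ^ 2) = 6 ∧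
    (4 * cos (π / 7) ^ 2) * (4 * cos (2 * π / 7) ^ 2) * (4 * cos (3 * π / 7) ^ 2) = 1 := by
  have hπ := pi_pos
  have h3 : 0 < cos (3 * π / 7) := cos_pos_of_mem_Ioo ⟨by linarith, by linarith⟩
  have h2 : 1 / 2 < cos (2 * π / 7) := by
    rw [← cos_pi_div_three]
    exact cos_lt_cos_of_nonneg_of_le_pi (by linarith) (by linarith) (by linarith)
  have h1 : cos (2 * π / 7) < cos (π / 7) :=
    cos_lt_cos_of_nonneg_of_le_pi (by linarith) (by linarith) (by linarith)
  have e2 : cos (2 * π / 7) = 2 * cos (π / 7) ^ 2 - 1 := by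
    rw [← cos_two_mul]; congr 1; ring
  have e3 : cos (3 * π / 7) = 4 * cos (π / 7) ^ 3 - 3 * cos (π / 7) := by
    rw [← cos_three_mul]; congr 1; ring
  have e4 : 2 * cos (2 * π / 7) ^ 2 - 1 = -cos (3 * π / 7) := by
    rw [← cos_two_mul, ← cos_pi_sub]; congr 1; ring
  refine ⟨h3, h2, h1, ?_⟩
  rw [e2, e3] at e4
  rw [e2, e3]
  have hc : 0 < cos (π / 7) := by linarith
  generalize cos (π / 7) = c at *
  have hp : 8 * c ^ 3 - 4 * c ^ 2 - 4 * c + 1 = 0 := by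
    have : (c + 1) * (8 * c ^ 3 - 4 * c ^ 2 - 4 * c + 1) = 0 := by linear_combination e4
    exact (mul_eq_zero.1 this).resolve_left (by linarith)
  have c2 : 4 * c ^ 3 - 3 * c = 2 * c ^ 2 - c - 1 / 2 := by linear_combination hp / 2
  rw [c2]
  refine ⟨?_, ?_, ?_⟩
  · linear_combination 4 * c * hp
  · linear_combination (-2 + 8 * c + 12 * c ^ 2 - 16 * c ^ 3 - 16 * c ^ 4 + 32 * c ^ 5) * hp
  · linear_combination (-1 - 4 * c - 4 * c ^ 2 + 40 * c ^ 3 + 48 * c ^ 4 - 128 * c ^ 5 - 64 * c ^ 6 +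
      128 * c ^ 7) * hp

/-- The positive solution of a cyclic system of equations in terms of the roots of a cubic. -/
theorem cyclic_system_solution {u v w x₁ x₂ x₃ : ℝ} (hv : 1 < v) (hu : 1 < u) (hw : 0 < w)
    (h : u * v * w = 1) (h₁ : u ^ 3 * v + v ^ 3 * w + w ^ 3 * u = 6)
    (h₂ : u ^ 2 * v ^ 3 + v ^ 2 * w ^ 3 + w ^ 2 * u ^ 3 = 5)
    (hx₃ : 0 < x₃) (hx₂ : 1 < x₂) (hx₁ : x₂ < x₁) (e₁ : x₁ + x₂ + x₃ = 5)
    (e₂ : x₁ * x₂ + x₂ * x₃ + x₃ * x₁ = 6) (e₃ : x₁ * x₂ * x₃ = 1) :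
    u ^ 7 = x₂ / x₃ ^ 2 ∧ v ^ 7 = x₁ / x₂ ^ 2 ∧ w ^ 7 = x₃ / x₁ ^ 2 := by
  have hv0 : 0 < v := by linarith
  have hu0 : 0 < u := by linarith
  have hx10 : 0 < x₁ := by linarith
  have hx20 : 0 < x₂ := by linarith
  -- These monomials have elementary symmetric functions 6, 5, 1, so they are the reciprocals of the
  -- x_i. The inequalities fix the matching: α = 1/x₃, β = 1/x₂, γ = 1/x₁.
  obtain ⟨α, hα⟩ : ∃ α, α = u ^ 3 * v := ⟨_, rfl⟩
  obtain ⟨β, hβ⟩ : ∃ β, β = v ^ 3 * w := ⟨_, rfl⟩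
  obtain ⟨γ, hγ⟩ : ∃ γ, γ = w ^ 3 * u := ⟨_, rfl⟩
  have hβ0 : 0 < β := by rw [hβ]; positivity
  have hγ0 : 0 < γ := by rw [hγ]; positivity
  have hα0 : 0 < α := by rw [hα]; positivity
  have s1 : α + β + γ = 6 := by rw [hα, hβ, hγ, h₁]
  have s2 : α * β + β * γ + γ * α = 5 := by
    rw [hα, hβ, hγ]
    linear_combination h₂ + (u ^ 2 * v ^ 3 + v ^ 2 * w ^ 3 + w ^ 2 * u ^ 3) * h
  have s3 : α * β * γ = 1 := by
    rw [hα, hβ, hγ]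
    linear_combination (u * v * w + 1) * ((u * v * w) ^ 2 + 1) * h
  have hα1 : 1 < α := by
    rw [hα]
    exact one_lt_mul_of_lt_of_le (one_lt_pow₀ hu (by norm_num)) hv.le
  have hw1 : w < 1 := by
    by_contra! hw'
    have : 1 < u * v * w :=
      one_lt_mul_of_lt_of_le (one_lt_mul_of_lt_of_le hu hv.le) hw'
    linarith
  have hβγ : γ < β := by
    have hb : w < β := by
      rw [hβ]
      exact lt_mul_of_one_lt_left hw (one_lt_pow₀ hv (by norm_num))
    have huw : u * w < 1 := by
      rw [← h]
      linarith [lt_mul_of_one_lt_right (mul_pos hu0 hw) hv]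
    have hc : γ < w := by
      have huww : u * w * w < 1 := mul_lt_one_of_nonneg_of_lt_one_right huw.le hw.le hw1
      rw [hγ, show w ^ 3 * u = (u * w * w) * w by ring]
      exact mul_lt_of_lt_one_left hw huww
    linarith
  have hroot : (x₁ * α - 1) * ((x₂ * α - 1) * (x₃ * α - 1)) = 0 := by
    linear_combination α ^ 3 * e₃ - α ^ 2 * e₂ + α * e₁ + α ^ 2 * s1 - α * s2 + s3
  have r3 : x₃ * α = 1 := by
    have h1 : 1 < x₁ * α := one_lt_mul_of_lt_of_le (hx₂.trans hx₁) hα1.le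
    have h2 : 1 < x₂ * α := one_lt_mul_of_lt_of_le hx₂ hα1.le
    have h3 := (mul_eq_zero.1 hroot).resolve_left (by linarith)
    have h4 := (mul_eq_zero.1 h3).resolve_left (by linarith)
    linarith
  have hβγ' : β * γ = x₃ := by
    have : x₃ * α * (β * γ) = x₃ := by linear_combination x₃ * s3
    rwa [r3, one_mul] at this
  have hxα : x₁ * x₂ = α := by linear_combination α * e₃ - x₁ * x₂ * r3
  have hβ' : (x₁ * β - 1) * (x₂ * β - 1) = 0 := by
    linear_combination β ^ 2 * hxα - β * e₁ + β * s2 - s3 - β * hβγ'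
  have r2 : x₂ * β = 1 := by
    rcases mul_eq_zero.1 hβ' with h0 | h0
    · have hγ' : x₂ * γ = 1 := by
        linear_combination e₃ + x₁ * x₂ * hβγ' - x₂ * γ * h0
      have := mul_lt_mul hx₁ hβγ.le hγ0 hx10.le
      linarith
    · linarith
  have r1 : x₁ * γ = 1 := by
    linear_combination e₃ + x₁ * x₂ * hβγ' - x₁ * γ * r2
  have k1 : u ^ 7 * β = α ^ 2 := by
    rw [hα, hβ]; linear_combination u ^ 6 * v ^ 2 * h
  have k2 : v ^ 7 * γ = β ^ 2 := by
    rw [hγ, hβ]; linear_combination v ^ 6 * w ^ 2 * h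
  have k3 : w ^ 7 * α = γ ^ 2 := by
    rw [hα, hγ]; linear_combination w ^ 6 * u ^ 2 * h
  refine ⟨?_, ?_, ?_⟩
  · rw [eq_div_iff (by positivity)]
    linear_combination x₂ * x₃ ^ 2 * k1 - u ^ 7 * x₃ ^ 2 * r2 + x₂ * (x₃ * α + 1) * r3
  · rw [eq_div_iff (by positivity)]
    linear_combination x₁ * x₂ ^ 2 * k2 - v ^ 7 * x₂ ^ 2 * r1 + x₁ * (x₂ * β + 1) * r2
  · rw [eq_div_iff (by positivity)]
    linear_combination x₃ * x₁ ^ 2 * k3 - w ^ 7 * x₁ ^ 2 * r3 + x₃ * (x₁ * γ + 1) * r1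

/-! ### Evaluations at r = exp(-π√7/49). -/

theorem thetaResidue_seven_zero (r : ℝ) : thetaResidue 7 r 0 = ramanujanPhi (r ^ 49) := by
  rw [thetaResidue_zero, show (7 : ℤ) ^ 2 = ((49 : ℕ) : ℤ) by norm_num, zpow_natCast]

/-- Comparison with a geometric series, by n² ≥ |n|. -/
theorem ramanujanPhi_le {q : ℝ} (hq : 0 < q) (hq1 : q < 1) :
    ramanujanPhi q ≤ (1 + q) / (1 - q) := by
  have hg := hasSum_geometric_of_lt_one hq.le hq1
  have hsum : HasSum (fun n : ℤ => q ^ n.natAbs) ((1 - q)⁻¹ + q * (1 - q)⁻¹) := by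
    refine HasSum.of_nat_of_neg_add_one (hg.congr_fun fun n => by simp)
      ((hg.mul_left q).congr_fun fun n => ?_)
    rw [show (-((n : ℤ) + 1)).natAbs = n + 1 by omega, pow_succ']
  rw [show (1 + q) / (1 - q) = (1 - q)⁻¹ + q * (1 - q)⁻¹ by ring]
  refine hasSum_le (fun n => ?_) (hasSum_ramanujanPhi hq hq1) hsum
  have e : q ^ (n ^ 2) = q ^ (n.natAbs ^ 2) := by
    rw [← zpow_natCast q (n.natAbs ^ 2)]
    push_cast
    rw [sq_abs]
  rw [e]
  exact pow_le_pow_of_le_one hq.le hq1.le (Nat.le_self_pow (by norm_num) _)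

theorem pow_sq_le_thetaResidue {r : ℝ} (hr : 0 < r) (hr1 : r < 1) (j : ℕ) :
    r ^ (j ^ 2) ≤ thetaResidue 7 r j := by
  have h := le_hasSum (hasSum_thetaResidue (N := 7) (by norm_num) hr hr1 j) 0
    fun k _ => (zpow_pos hr _).le
  rw [mul_zero, zero_add] at h
  exact_mod_cast h

/-- With r = exp(-π√7/49) this reads a₀ < 2r⁴. Since a₁ ≥ r and a₂ ≥ r⁴, it makes 2a₁/a₀ and 2a₂/a₀
exceed 1, which selects the right solution of the cyclic system. -/
theorem ramanujanPhi_lt_two_mul_exp :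
    ramanujanPhi (exp (-π * √7)) < 2 * exp (-π * √7 / 49) ^ 4 := by
  have h7 : √(7 : ℝ) < 2.6458 := by
    rw [sqrt_lt' (by norm_num)]; norm_num
  have h7' : 2.645 < √(7 : ℝ) := by
    rw [lt_sqrt (by norm_num)]; norm_num
  have hu : π * √7 < 3.1416 * 2.6458 :=
    mul_lt_mul'' pi_lt_d4 h7 pi_pos.le (sqrt_nonneg 7)
  have hl : 3.1415 * 2.645 < π * √7 :=
    mul_lt_mul'' pi_gt_d4 h7' (by norm_num) (by norm_num)
  have hq : exp (-π * √7) ≤ 1 / 256 := by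
    have h1 : exp (-π * √7) ≤ exp (-1) ^ 8 := by
      rw [← exp_nat_mul]
      exact exp_le_exp.2 (by push_cast; linarith)
    have h2 : exp (-1) ≤ 1 / 2 := by
      rw [exp_neg, one_div]
      exact inv_anti₀ (by norm_num) (by linarith [exp_one_gt_d9])
    calc _ ≤ exp (-1) ^ 8 := h1
      _ ≤ (1 / 2) ^ 8 := pow_le_pow_left₀ (exp_pos _).le h2 8
      _ = 1 / 256 := by norm_num
  have hφ := ramanujanPhi_le (exp_pos (-π * √7)) (by linarith)
  have hr : 1.01 ≤ 2 * exp (-π * √7 / 49) ^ 4 := by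
    rw [← exp_nat_mul]
    nth_rewrite 1 [← exp_log (two_pos : (0 : ℝ) < 2)]
    rw [← exp_add]
    refine le_trans ?_ (add_one_le_exp _)
    push_cast
    linarith [log_two_gt_d9]
  refine (hφ.trans ?_).trans_lt (lt_of_lt_of_le (by norm_num : (1.009 : ℝ) < 1.01) hr)
  rw [div_le_iff₀ (by linarith)]
  linarith

theorem rpow_two_div_seven {y u : ℝ} (hy : 0 < y) (hu : 0 < u) (h : u ^ 7 = y ^ 2) :
    y ^ (2 / 7 : ℝ) = u := by
  have e : y ^ (2 / 7 : ℝ) = (y ^ 2) ^ (((7 : ℕ) : ℝ)⁻¹) := by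
    rw [← rpow_natCast, ← rpow_mul hy.le]
    norm_num
  rw [e, ← h, pow_rpow_inv_natCast hu.le (by norm_num)]

theorem exp_neg_pi_sqrt_seven_pow :
    exp (-π * √7 / 49) ^ 7 = exp (-π / √7) ∧ exp (-π * √7 / 49) ^ 49 = exp (-π * √7) ∧
    exp (-π / √7) ^ 7 = exp (-π * √7) ∧ exp (-π / √7) ^ 49 = exp (-7 * π * √7) := by
  have hs : √(7 : ℝ) ^ 2 = 7 := sq_sqrt (by norm_num)
  have hs0 : (0 : ℝ) < √7 := sqrt_pos.2 (by norm_num)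
  have hs1 : -π / √7 = -π * √7 / 7 := by
    rw [div_eq_div_iff hs0.ne' (by norm_num)]
    linear_combination π * hs
  rw [hs1]
  simp only [← exp_nat_mul]
  refine ⟨?_, ?_, ?_, ?_⟩ <;> congr 1 <;> push_cast <;> ring

theorem ramanujanPhi_inv_sqrt_seven_pow_four :
    ramanujanPhi (exp (-π / √7)) ^ 4 = 7 * ramanujanPhi (exp (-π * √7)) ^ 4 := by
  have hs : √(7 : ℝ) ^ 2 = 7 := sq_sqrt (by norm_num)
  have hs0 : (0 : ℝ) < √7 := sqrt_pos.2 (by norm_num)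
  have hss : √√(7 : ℝ) ^ 2 = √7 := sq_sqrt hs0.le
  have hss0 : 0 < √√(7 : ℝ) := sqrt_pos.2 hs0
  have hs4 : √√(7 : ℝ) ^ 4 = 7 := by
    rw [show √√(7 : ℝ) ^ 4 = (√√(7 : ℝ) ^ 2) ^ 2 by ring, hss, hs]
  rw [ramanujanPhi_exp_neg hs0, mul_pow, div_pow, hs4]
  ring

/-- At `q = exp (-π / √7)` the modular relation degenerates. -/
theorem eight_mul_thetaResidue_eq :
    8 * (thetaResidue 7 (exp (-π * √7 / 49)) 1 * thetaResidue 7 (exp (-π * √7 / 49)) 2 *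
      thetaResidue 7 (exp (-π * √7 / 49)) 3) = ramanujanPhi (exp (-π * √7)) ^ 3 := by
  obtain ⟨e1, e2, -, -⟩ := exp_neg_pi_sqrt_seven_pow
  have hr1 : exp (-π * √7 / 49) < 1 := by
    rw [exp_lt_one_iff]
    have : 0 < π * √7 := mul_pos pi_pos (sqrt_pos.2 (by norm_num))
    linarith
  have h := (thetaResidue_seven_relations (exp_pos _) hr1 (thetaResidue_seven_zero _) rfl rfl rfl
    (W := 7 * ramanujanPhi (exp (-π * √7)) ^ 4) (by rw [e1]; exact ramanujanPhi_inv_sqrt_seven_pow_four)).2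
  have ha : 0 < ramanujanPhi (exp (-π * √7)) := by
    rw [← e2, ← thetaResidue_seven_zero]
    exact thetaResidue_pos (by norm_num) (exp_pos _) hr1 0
  rw [e2] at h
  generalize ramanujanPhi (exp (-π * √7)) = a at *
  generalize thetaResidue 7 (exp (-π * √7 / 49)) 1 * thetaResidue 7 (exp (-π * √7 / 49)) 2 *
      thetaResidue 7 (exp (-π * √7 / 49)) 3 = P at *
  -- For W = 7a⁴ the terms 49 - 14 = 35 combine with -280P, so that a³ - 8P divides the whole
  -- relation; the cofactor is positive.
  have h' : (a ^ 3 - 8 * P) * (35 * a ^ 6 + (a ^ 3 - 8 * P) ^ 2) = 0 := by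
    linear_combination h
  have := (mul_eq_zero.1 h').resolve_right (by positivity)
  linarith

/-- The Weber function takes the value `√2` at `i √7`, so that `G₇ = 2^(1/4)`. -/
theorem ramanujanChi_exp_sqrt_seven :
    exp (π * √7 / 24) * ramanujanChi (exp (-π * √7)) = √2 := by
  obtain ⟨e1, e2, -, -⟩ := exp_neg_pi_sqrt_seven_pow
  have hs : √(7 : ℝ) ^ 2 = 7 := sq_sqrt (by norm_num)
  have hs0 : (0 : ℝ) < √7 := sqrt_pos.2 (by norm_num)
  have hs1 : -π / √7 = -π * √7 / 7 := by
    rw [div_eq_div_iff hs0.ne' (by norm_num)]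
    linear_combination π * hs
  have hπ : 0 < π * √7 := mul_pos pi_pos hs0
  have hr1 : exp (-π * √7 / 49) < 1 := by
    rw [exp_lt_one_iff]; linarith
  have h := thetaResidue_seven_mul_mul (exp_pos (-π * √7 / 49)) hr1
  have hinv := ramanujanChi_pow_six_inversion hs0
  rw [thetaResidue_seven_zero, e1, e2, ← eight_mul_thetaResidue_eq] at h
  have hP : 0 < thetaResidue 7 (exp (-π * √7 / 49)) 1 * thetaResidue 7 (exp (-π * √7 / 49)) 2 *
      thetaResidue 7 (exp (-π * √7 / 49)) 3 := by
    have := fun j => thetaResidue_pos (N := 7) (by norm_num) (exp_pos (-π * √7 / 49)) hr1 j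
    exact mul_pos (mul_pos (this 1) (this 2)) (this 3)
  have hc1 : 0 < ramanujanChi (exp (-π * √7)) :=
    ramanujanChi_pos (exp_pos _) (by rw [exp_lt_one_iff]; linarith)
  have hc0 : 0 < ramanujanChi (exp (-π / √7)) :=
    ramanujanChi_pos (exp_pos _) (by rw [exp_lt_one_iff, hs1]; linarith)
  generalize ramanujanChi (exp (-π * √7)) = χ₁ at *
  generalize ramanujanChi (exp (-π / √7)) = χ₀ at *
  generalize thetaResidue 7 (exp (-π * √7 / 49)) 1 * thetaResidue 7 (exp (-π * √7 / 49)) 2 *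
      thetaResidue 7 (exp (-π * √7 / 49)) 3 = P at *
  -- With this y, the Weber function is y^7 χ₁ at i√7 and y χ₀ at i/√7. Inversion makes the two
  -- equal, and the product relation becomes f^7 = 8f.
  obtain ⟨y, hy⟩ : ∃ y, y = exp (π * √7 / (24 * 7)) := ⟨_, rfl⟩
  have hy0 : 0 < y := hy ▸ exp_pos _
  have y7 : exp (π * √7 / 24) = y ^ 7 := by
    rw [hy, ← exp_nat_mul]; congr 1; push_cast; ring
  have y1 : exp (-π / (4 * √7)) * y ^ 6 = 1 := by
    rw [hy, ← exp_nat_mul, ← exp_add, exp_eq_one_iff, mul_comm 4, ← div_div, hs1]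
    push_cast; ring
  have y2 : exp (-π * √7 / 4) * y ^ 42 = 1 := by
    rw [hy, ← exp_nat_mul, ← exp_add, exp_eq_one_iff]
    push_cast; ring
  have y3 : exp (-π * √7 / 49) ^ 14 * y ^ 48 = 1 := by
    rw [hy, ← exp_nat_mul, ← exp_nat_mul, ← exp_add, exp_eq_one_iff]
    push_cast; ring
  rw [y7]
  have hf : (y ^ 7 * χ₁) ^ 6 = (y * χ₀) ^ 6 := by
    linear_combination y ^ 48 * hinv - y ^ 42 * χ₁ ^ 6 * y1 + y ^ 6 * χ₀ ^ 6 * y2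
  have hf' : y ^ 7 * χ₁ = y * χ₀ := (pow_left_inj₀ (by positivity) (by positivity) (by norm_num)).1 hf
  have h7 : χ₁ ^ 7 = 8 * exp (-π * √7 / 49) ^ 14 * χ₀ := by
    refine mul_left_cancel₀ hP.ne' ?_
    linear_combination h
  have hz : 0 < y ^ 7 * χ₁ := by positivity
  have h8 : (y ^ 7 * χ₁) * (y ^ 7 * χ₁) ^ 6 = (y ^ 7 * χ₁) * 8 := by
    linear_combination y ^ 49 * h7 + 8 * y * χ₀ * y3 - 8 * hf'
  have h6 := mul_left_cancel₀ hz.ne' h8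
  have h2 : √(2 : ℝ) ^ 6 = 8 := by
    rw [show √(2 : ℝ) ^ 6 = (√2 ^ 2) ^ 3 by ring, sq_sqrt (by norm_num)]; norm_num
  exact (pow_left_inj₀ hz.le (sqrt_nonneg 2) (by norm_num)).1 (h6.trans h2.symm)

/-- The evaluation of `φ(exp (-7 π √7))`. -/
theorem ramanujanPhi_exp_seven_sqrt_seven :
    (7 : ℝ) ^ (3 / 4 : ℝ) * ramanujanPhi (exp (-7 * π * √7)) = ramanujanPhi (exp (-π * √7)) *
      (1 + (cos (π / 7) / (2 * cos (2 * π / 7) ^ 2)) ^ (2 / 7 : ℝ)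
         + (cos (2 * π / 7) / (2 * cos (3 * π / 7) ^ 2)) ^ (2 / 7 : ℝ)
         + (cos (3 * π / 7) / (2 * cos (π / 7) ^ 2)) ^ (2 / 7 : ℝ)) := by
  obtain ⟨e1, e2, -, -⟩ := exp_neg_pi_sqrt_seven_pow
  have hs : √(7 : ℝ) ^ 2 = 7 := sq_sqrt (by norm_num)
  have hs0 : (0 : ℝ) < √7 := sqrt_pos.2 (by norm_num)
  have hr := exp_pos (-π * √7 / 49)
  have hr1 : exp (-π * √7 / 49) < 1 := by
    rw [exp_lt_one_iff]
    have : 0 < π * √7 := mul_pos pi_pos hs0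
    linarith
  have hφ : (7 : ℝ) ^ (3 / 4 : ℝ) * ramanujanPhi (exp (-7 * π * √7)) =
      ramanujanPhi (exp (-π * √7 / 49)) := by
    have h := ramanujanPhi_exp_neg (t := 7 * √7) (by positivity)
    have h34 : √(7 * √7) = (7 : ℝ) ^ (3 / 4 : ℝ) := by
      rw [sqrt_eq_rpow, sqrt_eq_rpow, ← rpow_one_add' (by norm_num) (by norm_num), ← rpow_mul (by norm_num)]
      norm_num
    rw [show -π * (7 * √7) = -7 * π * √7 by ring, h34,
      show -π / (7 * √7) = -π * √7 / 49 by
        rw [div_eq_div_iff (by positivity) (by norm_num)]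
        linear_combination 7 * π * hs] at h
    rw [h]
    field_simp
  rw [hφ, ramanujanPhi_eq_seven_dissection hr hr1]
  obtain ⟨R2, -⟩ := thetaResidue_seven_relations hr hr1 rfl rfl rfl rfl rfl
  have R1 := ramanujanPhi_pow_four hr hr1 rfl rfl rfl rfl
  rw [e1, ramanujanPhi_inv_sqrt_seven_pow_four] at R1
  have hp := eight_mul_thetaResidue_eq
  have hlt := ramanujanPhi_lt_two_mul_exp
  have hb1 : exp (-π * √7 / 49) ≤ thetaResidue 7 (exp (-π * √7 / 49)) 1 := by
    simpa only [one_pow, pow_one, Nat.cast_one] using pow_sq_le_thetaResidue hr hr1 1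
  have hb2 : exp (-π * √7 / 49) ^ 4 ≤ thetaResidue 7 (exp (-π * √7 / 49)) 2 := by
    simpa only [Nat.reducePow, Nat.cast_ofNat] using pow_sq_le_thetaResidue hr hr1 2
  have hr4 : exp (-π * √7 / 49) ^ 4 ≤ exp (-π * √7 / 49) := pow_le_of_le_one hr.le hr1.le (by norm_num)
  rw [thetaResidue_seven_zero, e2] at R1 R2
  rw [thetaResidue_seven_zero, e2]
  have ha3 := thetaResidue_pos (N := 7) (by norm_num) hr hr1 3
  have ha0 : 0 < ramanujanPhi (exp (-π * √7)) := by
    rw [← e2, ← thetaResidue_seven_zero]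
    exact thetaResidue_pos (by norm_num) hr hr1 0
  generalize thetaResidue 7 (exp (-π * √7 / 49)) 1 = a₁ at *
  generalize thetaResidue 7 (exp (-π * √7 / 49)) 2 = a₂ at *
  generalize thetaResidue 7 (exp (-π * √7 / 49)) 3 = a₃ at *
  generalize ramanujanPhi (exp (-π * √7)) = a₀ at *
  -- In these ratios, P = 1 reads uvw = 1, the quartic form with value 7a₀⁴ gives the cyclic sum 6,
  -- and the first minor relation gives the cyclic sum 5.
  obtain ⟨u, hu⟩ : ∃ u, u = 2 * a₁ / a₀ := ⟨_, rfl⟩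
  obtain ⟨v, hv⟩ : ∃ v, v = 2 * a₂ / a₀ := ⟨_, rfl⟩
  obtain ⟨w, hw⟩ : ∃ w, w = 2 * a₃ / a₀ := ⟨_, rfl⟩
  have hu1 : 1 < u := by rw [hu, one_lt_div ha0]; linarith
  have hv1 : 1 < v := by rw [hv, one_lt_div ha0]; linarith
  have hw0 : 0 < w := by rw [hw]; positivity
  have h₀ : u * v * w = 1 := by
    rw [hu, hv, hw]; field_simp; linear_combination hp
  have h₁ : u ^ 3 * v + v ^ 3 * w + w ^ 3 * u = 6 := by
    rw [hu, hv, hw]; field_simp; linear_combination -2 * R1 - 6 * a₀ * hp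
  have h₂ : u ^ 2 * v ^ 3 + v ^ 2 * w ^ 3 + w ^ 2 * u ^ 3 = 5 := by
    rw [hu, hv, hw]; field_simp
    refine mul_left_cancel₀ ha0.ne' ?_
    linear_combination -32 * R2 + (5 * a₀ ^ 3 + 8 * (a₁ * a₂ * a₃)) * hp
  obtain ⟨c3, c2, c1, E1, E2, E3⟩ := cos_pi_div_seven_relations
  have c2' : 0 < cos (2 * π / 7) := by linarith
  have hx₂ := pow_lt_pow_left₀ c2 (by norm_num) two_ne_zero
  have hx₁ := pow_lt_pow_left₀ c1 c2'.le two_ne_zero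
  obtain ⟨k1, k2, k3⟩ := cyclic_system_solution hv1 hu1 hw0 h₀ h₁ h₂
    (x₁ := 4 * cos (π / 7) ^ 2) (x₂ := 4 * cos (2 * π / 7) ^ 2) (x₃ := 4 * cos (3 * π / 7) ^ 2)
    (by positivity) (by linarith) (by linarith) E1 E2 E3
  have c1' : 0 < cos (π / 7) := by linarith
  rw [rpow_two_div_seven (u := v) (by positivity) (by linarith) (by rw [k2]; ring),
    rpow_two_div_seven (u := u) (by positivity) (by linarith) (by rw [k1]; ring),
    rpow_two_div_seven (u := w) (by positivity) hw0 (by rw [k3]; ring), hu, hv, hw]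
  field_simp
  ring

/-! ### Cardano's formula and the value of G₃₄₃. -/

/-- Cardano's formula for the real root of the degree seven modular relation. -/
theorem cardano_septic_relation {m s P : ℝ} (hm : 0 < m)
    (hs : s = 12 * m ^ 2 * (9 * (7 - m ^ 2) + √3 * √(27 * (m ^ 4 + 49) + 122 * m ^ 2)))
    (hP : m ^ 4 - (2 + 5 * P) * m ^ 2 + (1 - P) ^ 3 = 0) :
    0 < s ∧ P = 1 + 10 * m ^ 2 / s ^ (1 / 3 : ℝ) - s ^ (1 / 3 : ℝ) / 6 := by
  rw [← sqrt_mul (by norm_num)] at hs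
  obtain ⟨R, hR⟩ : ∃ R, R = √(3 * (27 * (m ^ 4 + 49) + 122 * m ^ 2)) := ⟨_, rfl⟩
  have hR0 : 0 ≤ R := hR ▸ sqrt_nonneg _
  have hR2 : R ^ 2 = 3 * (27 * (m ^ 4 + 49) + 122 * m ^ 2) := by
    rw [hR]; exact sq_sqrt (by positivity)
  rw [← hR] at hs
  have hm2 : 0 < m ^ 2 := by positivity
  have hpos : 0 < 9 * (7 - m ^ 2) + R := by
    -- The difference R² - 81(7 - m²)² equals 1500m².
    have : |9 * (7 - m ^ 2)| < R := abs_lt_of_sq_lt_sq (by rw [hR2]; nlinarith) hR0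
    linarith [(abs_lt.1 this).1]
  have hs0 : 0 < s := by rw [hs]; positivity
  refine ⟨hs0, ?_⟩
  obtain ⟨σ, hσ⟩ : ∃ σ, σ = s ^ (1 / 3 : ℝ) := ⟨_, rfl⟩
  have hσ0 : 0 < σ := hσ ▸ rpow_pos_of_pos hs0 _
  have hσ3 : σ ^ 3 = s := by
    rw [hσ, ← rpow_natCast, ← rpow_mul hs0.le]; norm_num
  rw [← hσ]
  have hs2 : s ^ 2 / 216 - 1000 * m ^ 6 = (7 * m ^ 2 - m ^ 4) * s := by
    rw [hs]; linear_combination 2 / 3 * m ^ 4 * hR2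
  -- With x = 1 - P the relation is x³ + 5m²x = 7m² - m⁴. Cardano's two summands are σ/6 and
  -- -10m²/σ, with product -5m²/3; the positive cofactor in `hfac` shows that the real root is
  -- unique.
  have hx : (σ / 6 - 10 * m ^ 2 / σ) ^ 3 + 5 * m ^ 2 * (σ / 6 - 10 * m ^ 2 / σ) =
      7 * m ^ 2 - m ^ 4 := by
    rw [← hσ3] at hs2
    field_simp
    field_simp at hs2
    linear_combination hs2
  obtain ⟨x, hxd⟩ : ∃ x, x = σ / 6 - 10 * m ^ 2 / σ := ⟨_, rfl⟩
  rw [← hxd] at hx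
  have hfac : (1 - P - x) * ((1 - P) ^ 2 + (1 - P) * x + x ^ 2 + 5 * m ^ 2) = 0 := by
    linear_combination hP - hx
  have := (mul_eq_zero.1 hfac).resolve_right (by
    nlinarith [sq_nonneg (1 - P + x), sq_nonneg (1 - P), sq_nonneg x])
  linarith

theorem exp_neg_pi_sqrt_343 : exp (-π * √((343 : ℚ) : ℝ)) = exp (-7 * π * √7) := by
  have : √((343 : ℚ) : ℝ) = 7 * √7 := by
    rw [show ((343 : ℚ) : ℝ) = 7 ^ 2 * 7 by norm_num, sqrt_mul (by norm_num),
      sqrt_sq (by norm_num)]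
  rw [this]; congr 1; ring

theorem mainTheorem2 (m s p : ℝ)
    (hm : m = (7 : ℝ) ^ (3 / 2 : ℝ) *
      (1 + (cos (π / 7) / (2 * cos (2 * π / 7) ^ 2)) ^ (2 / 7 : ℝ)
         + (cos (2 * π / 7) / (2 * cos (3 * π / 7) ^ 2)) ^ (2 / 7 : ℝ)
         + (cos (3 * π / 7) / (2 * cos (π / 7) ^ 2)) ^ (2 / 7 : ℝ)) ^ (-2 : ℤ))
    (hs : s = 12 * m ^ 2 *
      (9 * (7 - m ^ 2) + √3 * √(27 * (m ^ 4 + 49) + 122 * m ^ 2)))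
    (hp : p = 1 + 10 * m ^ 2 / s ^ (1 / 3 : ℝ) - s ^ (1 / 3 : ℝ) / 6) :
    m = ramanujanPhi (exp (-π * √7)) ^ 2 / ramanujanPhi (exp (-7 * π * √7)) ^ 2 ∧
    0 < s ∧ 0 < p ∧
    classInvariantG 343 = (2 : ℝ) ^ (1 / 4 : ℝ) * p ^ (-(1 / 7) : ℝ) := by
  obtain ⟨-, -, e3, e4⟩ := exp_neg_pi_sqrt_seven_pow
  have hs0 : (0 : ℝ) < √7 := sqrt_pos.2 (by norm_num)
  have hπ : 0 < π * √7 := mul_pos pi_pos hs0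
  have hr := exp_pos (-π / √7)
  have hr1 : exp (-π / √7) < 1 := by
    rw [exp_lt_one_iff, neg_div]
    exact neg_neg_of_pos (div_pos pi_pos hs0)
  have hφ1 : 0 < ramanujanPhi (exp (-π * √7)) :=
    ramanujanPhi_pos (exp_pos _) (by rw [exp_lt_one_iff]; linarith)
  have hφ7 : 0 < ramanujanPhi (exp (-7 * π * √7)) :=
    ramanujanPhi_pos (exp_pos _) (by rw [exp_lt_one_iff]; linarith)
  have hmφ : m = ramanujanPhi (exp (-π * √7)) ^ 2 / ramanujanPhi (exp (-7 * π * √7)) ^ 2 := by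
    have h := ramanujanPhi_exp_seven_sqrt_seven
    have h32 : (7 : ℝ) ^ (3 / 2 : ℝ) = ((7 : ℝ) ^ (3 / 4 : ℝ)) ^ 2 := by
      rw [← rpow_natCast, ← rpow_mul (by norm_num)]; norm_num
    have h34 : (0 : ℝ) < 7 ^ (3 / 4 : ℝ) := by positivity
    rw [hm, h32]
    generalize (1 + (cos (π / 7) / (2 * cos (2 * π / 7) ^ 2)) ^ (2 / 7 : ℝ)
         + (cos (2 * π / 7) / (2 * cos (3 * π / 7) ^ 2)) ^ (2 / 7 : ℝ)
         + (cos (3 * π / 7) / (2 * cos (π / 7) ^ 2)) ^ (2 / 7 : ℝ)) = S at *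
    generalize (7 : ℝ) ^ (3 / 4 : ℝ) = k at *
    have hS : S ≠ 0 := fun h0 => by
      rw [h0, mul_zero] at h
      exact (mul_pos h34 hφ7).ne' h
    rw [zpow_neg, ← div_eq_mul_inv, zpow_ofNat, div_eq_div_iff (by positivity) (by positivity)]
    linear_combination (k * ramanujanPhi (exp (-7 * π * √7)) +
      ramanujanPhi (exp (-π * √7)) * S) * h
  refine ⟨hmφ, ?_⟩
  have hm0 : 0 < m := by rw [hmφ]; positivity
  -- Here r = exp(-π/√7), so r^7 = e^{-π√7} and r^49 = e^{-7π√7}; dividing by a₀⁹ leaves the cubic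
  -- for P with φ(r^7)⁴/a₀⁴ = m².
  have hmod := (thetaResidue_seven_relations hr hr1 (thetaResidue_seven_zero _) rfl rfl rfl
    (by rw [e3])).2
  have hχ := thetaResidue_seven_mul_mul hr hr1
  rw [thetaResidue_seven_zero, e3, e4] at hχ
  rw [e4] at hmod
  have hT : 0 < thetaResidue 7 (exp (-π / √7)) 1 * thetaResidue 7 (exp (-π / √7)) 2 *
      thetaResidue 7 (exp (-π / √7)) 3 := by
    have := fun j => thetaResidue_pos (N := 7) (by norm_num) hr hr1 j
    exact mul_pos (mul_pos (this 1) (this 2)) (this 3)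
  have hG : classInvariantG 343 = (2 : ℝ) ^ (-(1 / 4) : ℝ) *
      (exp (7 * π * √7 / 24) * ramanujanChi (exp (-7 * π * √7))) := by
    rw [classInvariantG, exp_neg_pi_sqrt_343, ← exp_mul, mul_assoc]
    congr 3
    ring
  have hχ7 : 0 < ramanujanChi (exp (-7 * π * √7)) :=
    ramanujanChi_pos (exp_pos _) (by rw [exp_lt_one_iff]; linarith)
  have hf := ramanujanChi_exp_sqrt_seven
  generalize thetaResidue 7 (exp (-π / √7)) 1 * thetaResidue 7 (exp (-π / √7)) 2 *
      thetaResidue 7 (exp (-π / √7)) 3 = T at *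
  generalize ramanujanPhi (exp (-π * √7)) = b at *
  generalize ramanujanPhi (exp (-7 * π * √7)) = a at *
  obtain ⟨P, hPd⟩ : ∃ P, P = 8 * T / a ^ 3 := ⟨_, rfl⟩
  have hP0 : 0 < P := by rw [hPd]; positivity
  have hPT : P * a ^ 3 = 8 * T := by rw [hPd]; field_simp
  have hma : m * a ^ 2 = b ^ 2 := by rw [hmφ]; field_simp
  have hPm : m ^ 4 - (2 + 5 * P) * m ^ 2 + (1 - P) ^ 3 = 0 := by
    have h8 : 8 * T = P * a ^ 3 := hPT.symm
    have hb : b ^ 4 = m ^ 2 * a ^ 4 := by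
      linear_combination -(b ^ 2 + m * a ^ 2) * hma
    have hT' : T = P * a ^ 3 / 8 := by linarith
    rw [hb, hT'] at hmod
    refine mul_left_cancel₀ (pow_pos hφ7 9).ne' ?_
    linear_combination hmod
  obtain ⟨hs0', hPp⟩ := cardano_septic_relation hm0 hs hPm
  rw [← hp] at hPp
  rw [← hPp]
  refine ⟨hs0', hP0, ?_⟩
  rw [hG]
  obtain ⟨f, hfd⟩ : ∃ f, f = exp (7 * π * √7 / 24) * ramanujanChi (exp (-7 * π * √7)) := ⟨_, rfl⟩
  have hf0 : 0 < f := hfd ▸ mul_pos (exp_pos _) hχ7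
  rw [← hfd]
  -- The product formula says that P f^7 is 8 times the Weber function at i√7, whose value is √2.
  have hPf : P * f ^ 7 = 8 * √2 := by
    obtain ⟨y, hy⟩ : ∃ y, y = exp (π * √7 / 24) := ⟨_, rfl⟩
    have y7 : exp (7 * π * √7 / 24) = y ^ 7 := by
      rw [hy, ← exp_nat_mul]; congr 1; push_cast; ring
    have y14 : exp (-π / √7) ^ 14 * y ^ 48 = 1 := by
      rw [show exp (-π / √7) ^ 14 = (exp (-π / √7) ^ 7) ^ 2 by ring, e3, hy, ← exp_nat_mul,
        ← exp_nat_mul, ← exp_add, exp_eq_one_iff]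
      push_cast; ring
    rw [← hy] at hf
    rw [hfd, y7, ← hf]
    refine mul_left_cancel₀ (pow_pos hφ7 3).ne' ?_
    linear_combination y ^ 49 * ramanujanChi (exp (-7 * π * √7)) ^ 7 * hPT + 8 * y ^ 49 * hχ +
      8 * a ^ 3 * y * ramanujanChi (exp (-π * √7)) * y14
  have hpow : ((2 : ℝ) ^ (-(1 / 4) : ℝ) * f) ^ 7 = ((2 : ℝ) ^ (1 / 4 : ℝ) * P ^ (-(1 / 7) : ℝ)) ^ 7 := by
    obtain ⟨k, hk⟩ : ∃ k, k = (2 : ℝ) ^ (1 / 4 : ℝ) := ⟨_, rfl⟩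
    have hk0 : 0 < k := by rw [hk]; positivity
    have hk2 : √2 = k ^ 2 := by
      rw [hk, sqrt_eq_rpow, ← rpow_natCast, ← rpow_mul (by norm_num)]; norm_num
    have hk4 : k ^ 4 = 2 := by
      rw [hk, ← rpow_natCast, ← rpow_mul (by norm_num)]; norm_num
    have hP7 : (P ^ (-(1 / 7) : ℝ)) ^ 7 = P⁻¹ := by
      rw [← rpow_natCast, ← rpow_mul hP0.le, ← rpow_neg_one]; norm_num
    rw [rpow_neg (by norm_num), ← hk, mul_pow, mul_pow, hP7]
    rw [hk2] at hPf
    field_simp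
    linear_combination hPf - k ^ 2 * (k ^ 8 + 2 * k ^ 4 + 4) * hk4
  exact (pow_left_inj₀ (by positivity) (by positivity) (by norm_num)).1 hpow
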